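/- Let $n\ge 1$ and let $q_1,\dots,q_{n+2}$ be $n+2$ points spread evenly on the unit sphere $\mathbb S^n\subset\mathbb R^{n+1}$, that is, distinct points with all mutual distances equal (the vertices of an inscribed regular simplex). Let $\mathcal S_{n+2}(q)$ be the set of all rotations $\phi\in SO(n+1)$ that map the set $\{q_1,\dots,q_{n+2}\}$ onto itself. A function on $\mathbb S^n$ or on $\mathbb R^{n+1}$ is called $(n+2)$-symmetric if it is invariant under every $\phi\in\mathcal S_{n+2}(q)$ (almost everywhere, for functions in $H^1(\mathbb S^n)$). Then: (i) the best constant in the Poincaré inequality on mean-zero $(n+2)$-symmetric functions is $\lambda_1(n)=3(n+2)$; that is, $3(n+2)$ is the largest real number $\lambda$ such that $$\int_{\mathbb S^n}|\nabla\xi|^2\ \ge\ \lambda\int_{\mathbb S^n}\xi^2$$ for all $(n+2)$-symmetric $\xi\in H^1(\mathbb S^n)$ with $\int_{\mathbb S^n}\xi=0$; (ii) there is a nonzero $(n+2)$-symmetric homogeneous harmonic polynomial $h$ on $\mathbb R^{n+1}$ with $\int_{B_1}h(y)\,dy=0$, where $B_1$ is the unit ball, and the least degree of such a polynomial is $3$.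 -/

import Mathlib

open MeasureTheory
open scoped ContDiff

noncomputable section

namespace SimplexSphere

/-- Euclidean space of dimension `n + 1`. -/
abbrev Space (n : ℕ) : Type := EuclideanSpace ℝ (Fin (n + 1))

/-- The unit sphere `S^n`. -/
abbrev Sph (n : ℕ) : Type := Metric.sphere (0 : Space n) 1

/-- The surface measure on `S^n` induced by Lebesgue measure. -/
def surf (n : ℕ) : Measure (Sph n) :=
  (volume : Measure (Space n)).toSphere

/-- The `n + 2` points are spread evenly on `S^n`: they are distinct and all their mutual
distances agree, so that they are the vertices of an inscribed regular simplex. -/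
def EvenlySpread {n : ℕ} (q : Fin (n + 2) → Sph n) : Prop :=
  Function.Injective q ∧
    ∀ i j k l, i ≠ j → k ≠ l → dist (q i) (q j) = dist (q k) (q l)

/-- The rotations in `SO(n+1)` which map the set of the points `q i` onto itself. -/
def symRotations {n : ℕ} (q : Fin (n + 2) → Sph n) : Set (Space n ≃ₗᵢ[ℝ] Space n) :=
  {φ | LinearMap.det (φ.toLinearEquiv : Space n →ₗ[ℝ] Space n) = 1 ∧
    φ '' Set.range (fun i => (q i : Space n)) = Set.range (fun i => (q i : Space n))}

/-- The action of a linear isometry of the ambient space on the sphere. -/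
def onSphere {n : ℕ} (φ : Space n ≃ₗᵢ[ℝ] Space n) (x : Sph n) : Sph n :=
  ⟨φ x, by simp⟩

/-- `(n+2)`-symmetry of a function on the sphere that is given up to null sets. -/
def IsSymmetric {n : ℕ} (q : Fin (n + 2) → Sph n) (ξ : Sph n → ℝ) : Prop :=
  ∀ φ ∈ symRotations q, ∀ᵐ x ∂(surf n), ξ (onSphere φ x) = ξ x

/-- A smooth tangential vector field on the sphere, given by a smooth ambient extension. -/
def IsTangentField {n : ℕ} (X : Space n → Space n) : Prop :=
  ContDiff ℝ ∞ X ∧ ∀ x : Sph n, inner ℝ (X x) (x : Space n) = 0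

/-- The divergence on the sphere of a vector field: the trace of its derivative over the
tangent space at `x`, that is the full trace minus the normal contribution. -/
def sphereDiv {n : ℕ} (X : Space n → Space n) (x : Sph n) : ℝ :=
  LinearMap.trace ℝ (Space n) (fderiv ℝ X x : Space n →ₗ[ℝ] Space n)
    - inner ℝ (fderiv ℝ X x (x : Space n)) (x : Space n)

/-- `G` is a square integrable weak gradient of `ξ` on the sphere: it is tangential and
`∫ ξ div X = - ∫ ⟨G, X⟩` for all smooth tangential vector fields `X`. -/
structure IsWeakGradient {n : ℕ} (ξ : Sph n → ℝ) (G : Sph n → Space n) : Prop where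
  memLp : MemLp G 2 (surf n)
  tangent : ∀ᵐ x ∂(surf n), inner ℝ (G x) (x : Space n) = 0
  integral_by_parts : ∀ X : Space n → Space n, IsTangentField X →
    ∫ x, ξ x * sphereDiv X x ∂(surf n) = - ∫ x, inner ℝ (G x) (X x) ∂(surf n)

/-- The Sobolev space `H^1(S^n)`. -/
def MemH1 {n : ℕ} (ξ : Sph n → ℝ) : Prop :=
  MemLp ξ 2 (surf n) ∧ ∃ G : Sph n → Space n, IsWeakGradient ξ G

/-- The `(n+2)`-symmetric functions in `H^1(S^n)` of mean zero. -/
def symMeanZero {n : ℕ} (q : Fin (n + 2) → Sph n) : Set (Sph n → ℝ) :=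
  {ξ | MemH1 ξ ∧ ∫ x, ξ x ∂(surf n) = 0 ∧ IsSymmetric q ξ}

/-- The Poincaré inequality `∫ |∇ξ|² ≥ c ∫ ξ²` on the `(n+2)`-symmetric functions in
`H^1(S^n)` of mean zero. The weak gradient is unique up to null sets. -/
def PoincareInequality {n : ℕ} (q : Fin (n + 2) → Sph n) (c : ℝ) : Prop :=
  ∀ ξ ∈ symMeanZero q, ∀ G : Sph n → Space n, IsWeakGradient ξ G →
    c * ∫ x, ξ x ^ 2 ∂(surf n) ≤ ∫ x, ‖G x‖ ^ 2 ∂(surf n)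

/-- `h` is a nonzero harmonic polynomial on `ℝ^(n+1)`, homogeneous of degree `k`,
`(n+2)`-symmetric, and of mean zero over the unit ball. -/
structure IsSymHarmonic {n : ℕ} (q : Fin (n + 2) → Sph n) (k : ℕ)
    (h : MvPolynomial (Fin (n + 1)) ℝ) : Prop where
  ne_zero : h ≠ 0
  homogeneous : h.IsHomogeneous k
  harmonic : ∑ i, MvPolynomial.pderiv i (MvPolynomial.pderiv i h) = 0
  symmetric : ∀ φ ∈ symRotations q, ∀ y : Space n,
    MvPolynomial.eval (fun i => φ y i) h = MvPolynomial.eval (fun i => y i) h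
  mean_zero : ∫ y in Metric.ball (0 : Space n) 1, MvPolynomial.eval (fun i => y i) h = 0

end SimplexSphere

end

/-! The harmonic polynomials of degree `k` restrict to eigenfunctions of the spherical Laplacian
with eigenvalue `k * (k + n - 1)`, which is `3 * (n + 2)` at `k = 3`. Both claims thus reduce to one
fact: a symmetric mean-zero function has no component in degrees 0, 1, 2, while degree 3 contains a
symmetric harmonic polynomial.

Products of two vertex reflections are rotations that permute the vertices in 3-cycles. Since the
vertices span and sum to zero, an invariant linear form vanishes and an invariant symmetric bilinear
form is a multiple of the inner product (`EvenlySpread.linear_eq_zero`,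
`EvenlySpread.bilinear_eq_inner`). Applied to the first and second moments of a symmetric `ξ`, this
gives orthogonality to harmonics of degree 1 and 2; the mean-zero condition handles degree 0.

The inequality is `poincare_of_orthogonal`. It needs no completeness theorem for spherical
harmonics: `ξ` is approximated in `L²` by a polynomial, which agrees on the sphere with a sum of
harmonic ones, and a Bessel-type bound for the weak gradient supplies the eigenvalues. The
divergence theorem on the sphere, obtained from flat space in polar coordinates, makes the
tangential gradients of polynomials weak gradients.

Sharpness and existence come from the cubic `∑ ⟨q i, x⟩ ^ 3`, harmonic because the vertices sum to
zero. Pairing a symmetric harmonic of degree below 3 with itself shows that it would vanish. -/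

noncomputable section

namespace SimplexSphere

/-! ### Geometry of the regular simplex and invariants of its rotation group -/

section Simplex

variable {n : ℕ} {q : Fin (n + 2) → Sph n}

theorem inner_self_sph (x : Sph n) : inner ℝ (x : Space n) (x : Space n) = 1 := by
  rw [real_inner_self_eq_norm_sq]; simp

theorem EvenlySpread.exists_inner_eq (hq : EvenlySpread q) :
    ∃ c : ℝ, c ≠ 1 ∧ ∀ i j, i ≠ j → inner ℝ (q i : Space n) (q j : Space n) = c := by
  have key : ∀ i j, inner ℝ (q i : Space n) (q j : Space n) = 1 - dist (q i) (q j) ^ 2 / 2 := by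
    intro i j
    rw [Subtype.dist_eq, dist_eq_norm, norm_sub_sq_real]
    simp
    ring
  have h01 : (0 : Fin (n + 2)) ≠ 1 := by simp
  refine ⟨inner ℝ (q 0 : Space n) (q 1 : Space n), ?_, fun i j hij => ?_⟩
  · rw [key]
    have : dist (q 0) (q 1) ≠ 0 := dist_ne_zero.2 fun h => h01 (hq.1 h)
    intro h
    apply this
    have : dist (q 0) (q 1) ^ 2 = 0 := by linarith
    simpa using this
  · rw [key, key, hq.2 i j 0 1 hij h01]

theorem inner_sum_smul {c : ℝ}
    (hc : ∀ i j, i ≠ j → inner ℝ (q i : Space n) (q j : Space n) = c)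
    (a : Fin (n + 2) → ℝ) (j : Fin (n + 2)) :
    inner ℝ (∑ i, a i • (q i : Space n)) (q j : Space n) = (1 - c) * a j + c * ∑ i, a i := by
  have h1 : ∀ i, inner ℝ (a i • (q i : Space n)) (q j : Space n)
      = (if i = j then (1 - c) * a i else 0) + c * a i := by
    intro i
    rw [real_inner_smul_left]
    split_ifs with h
    · subst h; rw [inner_self_sph]; ring
    · rw [hc i j h]; ring
  rw [sum_inner, Finset.sum_congr rfl fun i _ => h1 i, Finset.sum_add_distrib, Finset.mul_sum]
  simp

/-- The Gram matrix is `(1 - c) I + c J` with `J` the all-ones matrix, so pairing a relation with `q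
j` determines `(1 - c) * a j` independently of `j`. -/
theorem eq_of_sum_smul_eq_zero {c : ℝ} (hc1 : c ≠ 1)
    (hc : ∀ i j, i ≠ j → inner ℝ (q i : Space n) (q j : Space n) = c)
    {a : Fin (n + 2) → ℝ} (ha : ∑ i, a i • (q i : Space n) = 0) (i j : Fin (n + 2)) :
    a i = a j := by
  have h1 := inner_sum_smul hc a i
  have h2 := inner_sum_smul hc a j
  rw [ha, inner_zero_left] at h1 h2
  exact mul_left_cancel₀ (sub_ne_zero.2 hc1.symm) (by linarith)

theorem EvenlySpread.sum_eq_zero (hq : EvenlySpread q) : ∑ i, (q i : Space n) = 0 := by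
  obtain ⟨c, hc1, hc⟩ := hq.exists_inner_eq
  -- There are `n + 2` vectors in dimension `n + 1`; a nontrivial relation has equal coefficients,
  -- which can be divided out.
  have hdep : ¬ LinearIndependent ℝ (fun i => (q i : Space n)) := by
    intro h
    have := h.fintype_card_le_finrank
    simp at this
  rw [Fintype.not_linearIndependent_iff] at hdep
  obtain ⟨a, ha, i, hi⟩ := hdep
  have : ∀ j, a j = a i := fun j => eq_of_sum_smul_eq_zero hc1 hc ha j i
  simp only [this, ← Finset.smul_sum] at ha
  exact (smul_eq_zero.1 ha).resolve_left hi

theorem EvenlySpread.inner_eq (hq : EvenlySpread q) {i j : Fin (n + 2)} (hij : i ≠ j) :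
    inner ℝ (q i : Space n) (q j : Space n) = - 1 / ((n : ℝ) + 1) := by
  obtain ⟨c, hc1, hc⟩ := hq.exists_inner_eq
  have h := inner_sum_smul hc (fun _ => 1) i
  simp only [one_smul, hq.sum_eq_zero, inner_zero_left] at h
  simp at h
  rw [hc i j hij]
  field_simp
  linarith

theorem EvenlySpread.span_eq_top (hq : EvenlySpread q) :
    Submodule.span ℝ (Set.range fun i => (q i : Space n)) = ⊤ := by
  obtain ⟨c, hc1, hc⟩ := hq.exists_inner_eq
  have hli : LinearIndependent ℝ (fun i : Fin (n + 1) => (q i.castSucc : Space n)) := by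
    rw [Fintype.linearIndependent_iff]
    intro g hg i
    -- Padding the relation by 0 at the last vertex forces every coefficient to equal that 0.
    have := eq_of_sum_smul_eq_zero hc1 hc (a := Fin.snoc g 0)
      (by rw [Fin.sum_univ_castSucc]; simpa using hg) i.castSucc (Fin.last _)
    simpa using this
  have := hli.span_eq_top_of_card_eq_finrank (by simp)
  rw [eq_top_iff, ← this]
  exact Submodule.span_mono (by rintro _ ⟨i, rfl⟩; exact ⟨i.castSucc, rfl⟩)

/-- The reflection that exchanges two vertices of the simplex. -/
def swapVertices (q : Fin (n + 2) → Sph n) (i j : Fin (n + 2)) : Space n ≃ₗᵢ[ℝ] Space n :=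
  (Submodule.span ℝ {(q i : Space n) - q j})ᗮ.reflection

theorem swapVertices_left (i j : Fin (n + 2)) : swapVertices q i j (q i) = q j :=
  Submodule.reflection_sub (by simp)

theorem swapVertices_right (i j : Fin (n + 2)) : swapVertices q i j (q j) = q i := by
  rw [← swapVertices_left (q := q) i j]
  exact Submodule.reflection_reflection _ _

theorem EvenlySpread.swapVertices_of_ne (hq : EvenlySpread q) {i j k : Fin (n + 2)} (hi : k ≠ i)
    (hj : k ≠ j) : swapVertices q i j (q k) = q k := by
  apply Submodule.reflection_mem_subspace_eq_self
  rw [Submodule.mem_orthogonal_singleton_iff_inner_left, inner_sub_right,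
    hq.inner_eq hi, hq.inner_eq hj, sub_self]

theorem EvenlySpread.det_swapVertices (hq : EvenlySpread q) {i j : Fin (n + 2)} (hij : i ≠ j) :
    LinearMap.det ((swapVertices q i j).toLinearEquiv : Space n →ₗ[ℝ] Space n) = -1 := by
  have hne : (q i : Space n) - q j ≠ 0 := sub_ne_zero.2 fun h => hij (hq.1 (Subtype.ext h))
  have := (Submodule.span ℝ {(q i : Space n) - q j})ᗮ.det_reflection
  rw [Submodule.orthogonal_orthogonal, finrank_span_singleton hne, pow_one] at this
  exact this

theorem EvenlySpread.swapVertices_mem_range (hq : EvenlySpread q) (i j k : Fin (n + 2)) :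
    swapVertices q i j (q k) ∈ Set.range (fun i => (q i : Space n)) := by
  by_cases hi : k = i
  · subst hi; exact ⟨j, (swapVertices_left _ _).symm⟩
  by_cases hj : k = j
  · subst hj; exact ⟨i, (swapVertices_right _ _).symm⟩
  exact ⟨k, (hq.swapVertices_of_ne hi hj).symm⟩

/-- A single vertex swap has determinant -1 and is not admissible; the product of two swaps sharing
a vertex is. -/
theorem EvenlySpread.exists_threeCycle (hq : EvenlySpread q) {i j k : Fin (n + 2)} (hij : i ≠ j)
    (hjk : j ≠ k) (hik : i ≠ k) :
    ∃ φ ∈ symRotations q, φ (q i) = q j ∧ φ (q j) = q k := by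
  refine ⟨(swapVertices q j k).trans (swapVertices q i j), ⟨?_, ?_⟩, ?_, ?_⟩
  · have h := LinearMap.det_comp ((swapVertices q i j).toLinearEquiv : Space n →ₗ[ℝ] Space n)
      ((swapVertices q j k).toLinearEquiv : Space n →ₗ[ℝ] Space n)
    rw [hq.det_swapVertices hij, hq.det_swapVertices hjk] at h
    norm_num at h
    exact h
  · have hsub : ∀ a b, (swapVertices q a b) '' Set.range (fun i => (q i : Space n)) =
        Set.range (fun i => (q i : Space n)) := by
      intro a b
      have h1 : (swapVertices q a b) '' Set.range (fun i => (q i : Space n)) ⊆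
          Set.range (fun i => (q i : Space n)) := by
        rintro _ ⟨_, ⟨l, rfl⟩, rfl⟩
        exact hq.swapVertices_mem_range a b l
      refine h1.antisymm fun x hx => ⟨swapVertices q a b x, ?_, ?_⟩
      · exact h1 ⟨x, hx, rfl⟩
      · exact Submodule.reflection_reflection _ _
    rw [LinearIsometryEquiv.coe_trans, Set.image_comp, hsub, hsub]
  · simp [hq.swapVertices_of_ne hij hik, swapVertices_left]
  · simp [swapVertices_left, hq.swapVertices_of_ne hik.symm hjk.symm]

theorem exists_third (hn : 1 ≤ n) (i j : Fin (n + 2)) : ∃ k, k ≠ i ∧ k ≠ j := by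
  have : ({i, j} : Finset (Fin (n + 2))).card < Fintype.card (Fin (n + 2)) := by
    have := Finset.card_le_two (a := i) (b := j)
    simp; omega
  obtain ⟨k, hk⟩ := Finset.exists_mem_notMem_of_card_lt_card
    (s := {i, j}) (t := (Finset.univ : Finset (Fin (n + 2)))) (by simpa using this)
  exact ⟨k, by simpa using hk⟩

theorem EvenlySpread.linear_eq_zero (hq : EvenlySpread q) (hn : 1 ≤ n) (l : Space n →ₗ[ℝ] ℝ)
    (hl : ∀ φ ∈ symRotations q, ∀ x, l (φ x) = l x) : l = 0 := by
  have hconst : ∀ i j, l (q i) = l (q j) := by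
    intro i j
    rcases eq_or_ne i j with rfl | hij
    · rfl
    obtain ⟨k, hki, hkj⟩ := exists_third hn i j
    obtain ⟨φ, hφ, h1, -⟩ := hq.exists_threeCycle hij hkj.symm hki.symm
    rw [← h1, hl φ hφ]
  have hsum : ∑ i, l (q i) = 0 := by rw [← map_sum, hq.sum_eq_zero, map_zero]
  refine LinearMap.ext_on_range hq.span_eq_top fun j => ?_
  rw [Finset.sum_congr rfl fun i _ => hconst i j] at hsum
  simp at hsum
  rcases hsum with h | h
  · exact absurd h (by positivity)
  · simpa using h

theorem EvenlySpread.bilinear_eq_inner (hq : EvenlySpread q) (hn : 1 ≤ n)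
    (B : Space n →ₗ[ℝ] Space n →ₗ[ℝ] ℝ) (hsymm : ∀ x y, B x y = B y x)
    (hB : ∀ φ ∈ symRotations q, ∀ x y, B (φ x) (φ y) = B x y) :
    ∃ c : ℝ, ∀ x y, B x y = c * inner ℝ x y := by
  have hdiag : ∀ i j, B (q i) (q i) = B (q j) (q j) := by
    intro i j
    rcases eq_or_ne i j with rfl | hij
    · rfl
    obtain ⟨k, hki, hkj⟩ := exists_third hn i j
    obtain ⟨φ, hφ, h1, -⟩ := hq.exists_threeCycle hij hkj.symm hki.symm
    rw [← h1, hB φ hφ]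
  have hadj : ∀ i j k, i ≠ j → j ≠ k → B (q i) (q j) = B (q j) (q k) := by
    intro i j k hij hjk
    -- The alternating group on three vertices is not doubly transitive, so reversing a pair has to
    -- use the symmetry of `B`.
    rcases eq_or_ne i k with rfl | hik
    · exact hsymm _ _
    obtain ⟨φ, hφ, h1, h2⟩ := hq.exists_threeCycle hij hjk hik
    rw [← h2, ← h1, hB φ hφ, h1]
  have hoff : ∀ i j k l, i ≠ j → k ≠ l → B (q i) (q j) = B (q k) (q l) := by
    intro i j k l hij hkl
    rcases eq_or_ne j k with rfl | hjk
    · exact hadj _ _ _ hij hkl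
    · rw [hadj i j k hij hjk, hadj j k l hjk hkl]
  set a := B (q 0) (q 0) with ha
  set b := B (q 0) (q 1) with hb
  have h01 : (0 : Fin (n + 2)) ≠ 1 := by simp
  have hab : a + (n + 1) * b = 0 := by
    have h0 : ∑ j, B (q 0) (q j) = 0 := by rw [← map_sum, hq.sum_eq_zero, map_zero]
    rw [Fin.sum_univ_succ, Finset.sum_congr rfl fun j _ =>
      hoff 0 (Fin.succ j) 0 1 (Fin.succ_ne_zero j).symm h01] at h0
    simpa using h0
  refine ⟨a, ?_⟩
  have hn0 : (n : ℝ) + 1 ≠ 0 := by positivity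
  have : B = a • innerₗ (Space n) := by
    refine LinearMap.ext_on_range hq.span_eq_top fun i =>
      LinearMap.ext_on_range hq.span_eq_top fun j => ?_
    rcases eq_or_ne i j with rfl | hij
    · simp [hdiag i 0]; simp [← ha]
    · have := hq.inner_eq hij
      simp [this, hoff i j 0 1 hij h01, ← hb]
      field_simp
      linarith
  intro x y
  rw [this]
  simp

end Simplex

/-! ### Decomposition of polynomials into harmonic ones -/

section HarmonicPolynomials

open MvPolynomial

/-- The Laplacian of a polynomial. -/
def lap (d : ℕ) : MvPolynomial (Fin d) ℝ →ₗ[ℝ] MvPolynomial (Fin d) ℝ :=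
  ∑ i, (pderiv i).toLinearMap ∘ₗ (pderiv i).toLinearMap

theorem lap_apply {d : ℕ} (p : MvPolynomial (Fin d) ℝ) :
    lap d p = ∑ i, pderiv i (pderiv i p) := by
  simp [lap, LinearMap.sum_apply]

/-- The squared norm of the variable as a polynomial. -/
def normSq (d : ℕ) : MvPolynomial (Fin d) ℝ := ∑ i, X i ^ 2

theorem isHomogeneous_normSq (d : ℕ) : (normSq d).IsHomogeneous 2 :=
  IsHomogeneous.sum _ _ _ fun i _ => by simpa using (isHomogeneous_X ℝ i).pow 2

theorem pderiv_normSq {d : ℕ} (i : Fin d) : pderiv i (normSq d) = 2 * X i := by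
  simp only [normSq, map_sum, Derivation.leibniz_pow, pderiv_X, Pi.single_apply]
  simp [two_mul]

theorem lap_normSq_mul {d k : ℕ} {f : MvPolynomial (Fin d) ℝ} (hf : f.IsHomogeneous k) :
    lap d (normSq d * f) = normSq d * lap d f + (2 * (d : ℝ) + 4 * k) • f := by
  have h1 : ∀ i : Fin d, pderiv i (pderiv i (normSq d * f)) =
      normSq d * pderiv i (pderiv i f) + 4 * (X i * pderiv i f) + 2 * f := by
    intro i
    have h2 : pderiv i (2 : MvPolynomial (Fin d) ℝ) = 0 := by
      rw [show (2 : MvPolynomial (Fin d) ℝ) = C 2 from (map_ofNat C 2).symm, pderiv_C]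
    simp only [Derivation.leibniz, pderiv_normSq, map_add, smul_eq_mul, h2, pderiv_X_self]
    ring
  rw [lap_apply, lap_apply, Finset.sum_congr rfl fun i _ => h1 i, Finset.sum_add_distrib,
    Finset.sum_add_distrib, ← Finset.mul_sum, ← Finset.mul_sum, hf.sum_X_mul_pderiv]
  have h2 : (C 2 : MvPolynomial (Fin d) ℝ) = 2 := map_ofNat C 2
  have h4 : (C 4 : MvPolynomial (Fin d) ℝ) = 4 := map_ofNat C 4
  simp [MvPolynomial.smul_eq_C_mul, h2, h4]
  ring

theorem lap_isHomogeneous {d k : ℕ} {f : MvPolynomial (Fin d) ℝ} (hf : f.IsHomogeneous (k + 2)) :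
    (lap d f).IsHomogeneous k := by
  rw [lap_apply]
  exact IsHomogeneous.sum _ _ _ fun i _ => hf.pderiv.pderiv

theorem lap_eq_zero_of_degree_le_one {d k : ℕ} (hk : k ≤ 1) {f : MvPolynomial (Fin d) ℝ}
    (hf : f.IsHomogeneous k) : lap d f = 0 := by
  rw [lap_apply]
  refine Finset.sum_eq_zero fun i _ => ?_
  have h : (pderiv i f).IsHomogeneous 0 := by
    have := hf.pderiv (i := i)
    rwa [Nat.sub_eq_zero_of_le hk] at this
  rw [← totalDegree_zero_iff_isHomogeneous, totalDegree_eq_zero_iff_eq_C] at h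
  rw [h, pderiv_C]

theorem normSq_pow_mul_isHomogeneous {d m : ℕ} {h : MvPolynomial (Fin d) ℝ}
    (hh : h.IsHomogeneous m) (j : ℕ) : (normSq d ^ j * h).IsHomogeneous (2 * j + m) :=
  ((isHomogeneous_normSq d).pow j).mul hh

theorem exists_lap_normSq_pow_mul {d m : ℕ} (hd : 0 < d) {h : MvPolynomial (Fin d) ℝ}
    (hh : h.IsHomogeneous m) (hl : lap d h = 0) (j : ℕ) :
    ∃ c : ℝ, 0 < c ∧ lap d (normSq d ^ (j + 1) * h) = c • (normSq d ^ j * h) := by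
  have hd' : (0 : ℝ) < d := by exact_mod_cast hd
  induction j with
  | zero =>
    refine ⟨2 * d + 4 * m, by positivity, ?_⟩
    rw [zero_add, pow_one, pow_zero, one_mul, lap_normSq_mul hh, hl, mul_zero, zero_add]
  | succ j ih =>
    obtain ⟨c, hc, h1⟩ := ih
    refine ⟨c + (2 * d + 4 * (2 * (j + 1) + m : ℕ)), by positivity, ?_⟩
    rw [pow_succ' _ (j + 1), mul_assoc, lap_normSq_mul (normSq_pow_mul_isHomogeneous hh (j + 1)),
      h1, add_smul c, mul_smul_comm, ← mul_assoc, ← pow_succ']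

/-- The span of the products of powers of the squared norm with harmonic polynomials, of total
degree `k`. -/
def radialHarmonic (d k : ℕ) : Submodule ℝ (MvPolynomial (Fin d) ℝ) :=
  Submodule.span ℝ {p | ∃ j m h, 2 * j + m = k ∧ IsHomogeneous h m ∧ lap d h = 0 ∧
    p = normSq d ^ j * h}

theorem radialHarmonic_isHomogeneous {d k : ℕ} {p : MvPolynomial (Fin d) ℝ}
    (hp : p ∈ radialHarmonic d k) : p.IsHomogeneous k := by
  rw [← mem_homogeneousSubmodule]
  revert p
  change radialHarmonic d k ≤ _
  rw [radialHarmonic, Submodule.span_le]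
  rintro _ ⟨j, m, h, rfl, hh, -, rfl⟩
  exact normSq_pow_mul_isHomogeneous hh j

/-- On each generator the Laplacian only lowers the power of `normSq` by one, up to a positive
factor, so a preimage is found by raising that power and rescaling. -/
theorem exists_lap_eq {d k : ℕ} (hd : 0 < d) {g : MvPolynomial (Fin d) ℝ}
    (hg : g ∈ radialHarmonic d k) : ∃ u ∈ radialHarmonic d (k + 2), lap d u = g := by
  suffices radialHarmonic d k ≤ (radialHarmonic d (k + 2)).map (lap d) from this hg
  rw [radialHarmonic, Submodule.span_le]
  rintro _ ⟨j, m, h, rfl, hh, hl, rfl⟩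
  obtain ⟨c, hc, h1⟩ := exists_lap_normSq_pow_mul hd hh hl j
  refine ⟨c⁻¹ • (normSq d ^ (j + 1) * h), Submodule.smul_mem _ _ (Submodule.subset_span
    ⟨j + 1, m, h, by ring, hh, hl, rfl⟩), ?_⟩
  rw [map_smul, h1, smul_smul, inv_mul_cancel₀ hc.ne', one_smul]

/-- By induction `lap d p` lies in the span two degrees lower, hence is the Laplacian of some `u` in
the span; then `p - u` is harmonic. -/
theorem mem_radialHarmonic {d k : ℕ} (hd : 0 < d) {p : MvPolynomial (Fin d) ℝ}
    (hp : p.IsHomogeneous k) : p ∈ radialHarmonic d k := by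
  have harm : ∀ {k : ℕ} {p : MvPolynomial (Fin d) ℝ}, p.IsHomogeneous k → lap d p = 0 →
      p ∈ radialHarmonic d k := fun {k p} hp hl =>
    Submodule.subset_span ⟨0, k, p, by simp, hp, hl, by simp⟩
  induction k using Nat.strong_induction_on generalizing p with
  | _ k ih =>
    rcases lt_or_ge k 2 with hk | hk
    · exact harm hp (lap_eq_zero_of_degree_le_one (by omega) hp)
    · obtain ⟨k, rfl⟩ := Nat.exists_eq_add_of_le' hk
      obtain ⟨u, hu, hlu⟩ := exists_lap_eq hd (ih k (by omega) (lap_isHomogeneous hp))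
      have h1 : p - u ∈ radialHarmonic d (k + 2) :=
        harm (hp.sub (radialHarmonic_isHomogeneous hu)) (by rw [map_sub, hlu, sub_self])
      simpa using add_mem h1 hu

variable {n : ℕ}

/-- The function on Euclidean space given by a polynomial. -/
def pEval (p : MvPolynomial (Fin (n + 1)) ℝ) (x : Space n) : ℝ := eval (fun i => x i) p

theorem pEval_normSq (x : Space n) : pEval (normSq (n + 1)) x = ‖x‖ ^ 2 := by
  simp [pEval, normSq, EuclideanSpace.real_norm_sq_eq]

theorem exists_harmonic_decomposition (p : MvPolynomial (Fin (n + 1)) ℝ) :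
    ∃ H : ℕ →₀ MvPolynomial (Fin (n + 1)) ℝ,
      (∀ k, (H k).IsHomogeneous k ∧ lap (n + 1) (H k) = 0) ∧
      ∀ x : Sph n, pEval p x = H.sum fun _ h => pEval h x := by
  -- The decomposable polynomials form a subspace, so only the generators `normSq ^ j * h` need
  -- checking, and there `normSq` is 1 on the sphere.
  let S : Submodule ℝ (MvPolynomial (Fin (n + 1)) ℝ) :=
    { carrier := {p | ∃ H : ℕ →₀ MvPolynomial (Fin (n + 1)) ℝ,
        (∀ k, (H k).IsHomogeneous k ∧ lap (n + 1) (H k) = 0) ∧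
        ∀ x : Sph n, pEval p x = H.sum fun _ h => pEval h x}
      zero_mem' := ⟨0, fun k => ⟨isHomogeneous_zero _ _ _, by simp⟩, by simp [pEval]⟩
      add_mem' := by
        rintro a b ⟨H, h1, h2⟩ ⟨K, k1, k2⟩
        refine ⟨H + K, fun k => ⟨(h1 k).1.add (k1 k).1, ?_⟩, fun x => ?_⟩
        · rw [Finsupp.add_apply, map_add, (h1 k).2, (k1 k).2, add_zero]
        · rw [Finsupp.sum_add_index' (by simp [pEval]) (by simp [pEval]), ← h2, ← k2]
          simp [pEval]
      smul_mem' := by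
        rintro c a ⟨H, h1, h2⟩
        refine ⟨c • H, fun k => ⟨?_, ?_⟩, fun x => ?_⟩
        · exact (homogeneousSubmodule (Fin (n + 1)) ℝ k).smul_mem c (h1 k).1
        · rw [Finsupp.smul_apply, map_smul, (h1 k).2, smul_zero]
        · rw [Finsupp.sum_smul_index' (by simp [pEval])]
          have := h2 x
          simp only [pEval, smul_eval] at this ⊢
          rw [this, Finsupp.mul_sum] }
  change p ∈ S
  rw [← sum_homogeneousComponent p]
  refine Submodule.sum_mem _ fun k _ => ?_
  have hle : radialHarmonic (n + 1) k ≤ S := by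
    rw [radialHarmonic, Submodule.span_le]
    rintro _ ⟨j, m, h, -, hh, hl, rfl⟩
    refine ⟨Finsupp.single m h, fun i => ?_, fun x => ?_⟩
    · rcases eq_or_ne m i with rfl | hi
      · simpa using ⟨hh, hl⟩
      · rw [Finsupp.single_eq_of_ne' hi]
        exact ⟨isHomogeneous_zero _ _ _, map_zero _⟩
    · rw [Finsupp.sum_single_index (by simp [pEval])]
      have := pEval_normSq (x : Space n)
      simp only [pEval] at this
      simp [pEval, this]
  exact hle (mem_radialHarmonic (Nat.succ_pos n) (homogeneousComponent_isHomogeneous k p))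

end HarmonicPolynomials

/-! ### Surface measure and the divergence theorem on the sphere -/

section Divergence

variable {n : ℕ}

instance : IsFiniteMeasure (surf n) := inferInstanceAs (IsFiniteMeasure (Measure.toSphere _))

instance : (surf n).IsOpenPosMeasure := inferInstanceAs (Measure.toSphere _).IsOpenPosMeasure

theorem onSphere_apply (φ : Space n ≃ₗᵢ[ℝ] Space n) (x : Sph n) :
    (onSphere φ x : Space n) = φ x := rfl

theorem continuous_onSphere (φ : Space n ≃ₗᵢ[ℝ] Space n) : Continuous (onSphere φ) :=
  (φ.continuous.comp continuous_subtype_val).subtype_mk _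

open scoped Pointwise in
-- The surface measure of a set is, up to a constant, the volume of the cone over it, and a linear
-- isometry maps cones to cones preserving volume.
theorem measurePreserving_onSphere (φ : Space n ≃ₗᵢ[ℝ] Space n) :
    MeasurePreserving (onSphere φ) (surf n) (surf n) := by
  refine ⟨(continuous_onSphere φ).measurable, Measure.ext fun s hs => ?_⟩
  have hm := (continuous_onSphere φ).measurable
  rw [Measure.map_apply hm hs, surf, Measure.toSphere_apply' _ hs, Measure.toSphere_apply' _ (hm hs)]
  congr 1
  have : Set.Ioo (0 : ℝ) 1 • ((↑) '' (onSphere φ ⁻¹' s) : Set (Space n)) =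
      φ ⁻¹' (Set.Ioo (0 : ℝ) 1 • ((↑) '' s : Set (Space n))) := by
    ext x
    simp only [Set.mem_smul, Set.mem_image, Set.mem_preimage]
    constructor
    · rintro ⟨r, hr, _, ⟨u, hu, rfl⟩, rfl⟩
      exact ⟨r, hr, _, ⟨_, hu, rfl⟩, by simp [onSphere_apply]⟩
    · rintro ⟨r, hr, _, ⟨u, hu, rfl⟩, h⟩
      have e : onSphere φ (onSphere φ.symm u) = u := Subtype.ext (by simp [onSphere_apply])
      refine ⟨r, hr, _, ⟨onSphere φ.symm u, by rwa [e], rfl⟩, ?_⟩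
      apply φ.injective
      rw [← h, onSphere_apply]
      simp
  rw [this]
  exact φ.measurePreserving.measure_preimage_equiv (f := φ.toMeasurableEquiv) _

theorem integral_comp_onSphere (φ : Space n ≃ₗᵢ[ℝ] Space n) (f : Sph n → ℝ) :
    ∫ x, f (onSphere φ x) ∂(surf n) = ∫ x, f x ∂(surf n) := by
  have hemb : MeasurableEmbedding (onSphere φ) := by
    let e : Sph n ≃ₜ Sph n :=
      { toFun := onSphere φ
        invFun := onSphere φ.symm
        left_inv := fun x => Subtype.ext (by simp [onSphere_apply])
        right_inv := fun x => Subtype.ext (by simp [onSphere_apply])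
        continuous_toFun := continuous_onSphere φ
        continuous_invFun := continuous_onSphere φ.symm }
    exact e.measurableEmbedding
  exact (measurePreserving_onSphere φ).integral_comp hemb f

theorem integral_eq_radial_mul_spherical {F : Space n → ℝ} {a : ℝ → ℝ} {g : Sph n → ℝ}
    (h : ∀ (u : Sph n) (r : ℝ), 0 < r → F (r • (u : Space n)) = a r * g u) :
    ∫ x, F x = (∫ r : Set.Ioi (0 : ℝ), a r ∂(Measure.volumeIoiPow n)) * ∫ u, g u ∂(surf n) := by
  have hd : Module.finrank ℝ (Space n) - 1 = n := by simp
  calc ∫ x, F x = ∫ x : ({(0)}ᶜ : Set (Space n)), F x ∂(volume.comap Subtype.val) := by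
        rw [integral_subtype_comap (measurableSet_singleton _).compl F,
          MeasureTheory.restrict_compl_singleton]
    _ = ∫ p : Sph n × Set.Ioi (0 : ℝ), F ((p.2 : ℝ) • (p.1 : Space n))
          ∂((surf n).prod (.volumeIoiPow n)) := by
        have := (volume : Measure (Space n)).measurePreserving_homeomorphUnitSphereProd.integral_comp
          (Homeomorph.measurableEmbedding _)
          (fun p : Sph n × Set.Ioi (0 : ℝ) => F ((p.2 : ℝ) • (p.1 : Space n)))
        rw [hd] at this
        rw [surf, ← this]
        refine integral_congr_ae (.of_forall fun x => ?_)
        have hx : ‖(x : Space n)‖ ≠ 0 := norm_ne_zero_iff.2 x.2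
        simp [smul_smul, hx]
    _ = ∫ p : Sph n × Set.Ioi (0 : ℝ), g p.1 * a p.2 ∂((surf n).prod (.volumeIoiPow n)) :=
        integral_congr_ae (.of_forall fun p => by
          simp only [h p.1 p.2 p.2.2, mul_comm])
    _ = _ := by
        rw [integral_prod_mul (fun u => g u) (fun r : Set.Ioi (0 : ℝ) => a r), mul_comm]

theorem integral_trace_fderiv_eq_zero {Z : Space n → Space n} (hZ : ContDiff ℝ 1 Z)
    (hc : HasCompactSupport Z) :
    ∫ x, LinearMap.trace ℝ (Space n) (fderiv ℝ Z x : Space n →ₗ[ℝ] Space n) = 0 := by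
  let b := EuclideanSpace.basisFun (Fin (n + 1)) ℝ
  have hcont : ∀ i, Continuous fun x => inner ℝ (b i) (fderiv ℝ Z x (b i)) := fun i =>
    continuous_const.inner ((hZ.continuous_fderiv (by simp)).clm_apply continuous_const)
  have hcs : HasCompactSupport (fderiv ℝ Z) := hc.fderiv ℝ
  have hint : ∀ i, Integrable fun x => inner ℝ (b i) (fderiv ℝ Z x (b i)) := fun i =>
    (hcont i).integrable_of_hasCompactSupport
      (hcs.comp_left (g := fun L : Space n →L[ℝ] Space n => inner ℝ (b i) (L (b i))) (by simp))
  have htr : ∀ x, LinearMap.trace ℝ (Space n) (fderiv ℝ Z x : Space n →ₗ[ℝ] Space n) =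
      ∑ i, inner ℝ (b i) (fderiv ℝ Z x (b i)) := fun x =>
    LinearMap.trace_eq_sum_inner _ b
  simp only [htr]
  rw [integral_finsetSum _ fun i _ => hint i]
  refine Finset.sum_eq_zero fun i _ => ?_
  have hfd : ∀ x, fderiv ℝ (fun x => inner ℝ (b i) (Z x)) x (b i) =
      inner ℝ (b i) (fderiv ℝ Z x (b i)) := by
    intro x
    have hd : HasFDerivAt Z (fderiv ℝ Z x) x := ((hZ.differentiable (by simp)) x).hasFDerivAt
    have := ((innerSL ℝ (b i)).hasFDerivAt (x := Z x)).comp x hd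
    have h2 : fderiv ℝ (fun x => inner ℝ (b i) (Z x)) x = _ := this.fderiv
    rw [h2]
    simp
  have hdiff : Differentiable ℝ fun x => inner ℝ (b i) (Z x) :=
    (contDiff_const.inner ℝ hZ).differentiable (by simp)
  -- Integration by parts against the constant 1 says that a directional derivative of a compactly
  -- supported function integrates to zero.
  have := integral_mul_fderiv_eq_neg_fderiv_mul_of_integrable (μ := (volume : Measure (Space n)))
    (f := fun _ => (1 : ℝ)) (g := fun x => inner ℝ (b i) (Z x)) (v := b i)
    (by simp) (by simpa [hfd] using hint i)
    (by
      simp only [one_mul]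
      exact (continuous_const.inner hZ.continuous).integrable_of_hasCompactSupport
        (hc.comp_left (g := fun y => inner ℝ (b i) y) (by simp)))
    (fun x _ => differentiableAt_const _) (fun x _ => hdiff x)
  simpa [hfd] using this

/-- A smooth radial profile supported away from the origin. -/
def radialBump : ContDiffBump (2 : ℝ) := ⟨1 / 2, 1, by norm_num, by norm_num⟩

/-- The extension of a field on the sphere to a compactly supported field on the ambient space
which is constant, up to the radial factor, on rays. -/
def radialExtension (Y : Space n → Space n) (x : Space n) : Space n :=
  (‖x‖ * radialBump ‖x‖) • Y (‖x‖⁻¹ • x)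

theorem radialBump_eq_zero {r : ℝ} (hr : r ≤ 1 ∨ 3 ≤ r) : radialBump r = 0 := by
  apply radialBump.zero_of_le_dist
  rw [Real.dist_eq]
  change (1 : ℝ) ≤ _
  rcases hr with h | h
  · rw [abs_sub_comm]; exact (by linarith : (1 : ℝ) ≤ 2 - r).trans (le_abs_self _)
  · exact (by linarith : (1 : ℝ) ≤ r - 2).trans (le_abs_self _)

theorem hasCompactSupport_radialExtension (Y : Space n → Space n) :
    HasCompactSupport (radialExtension Y) := by
  refine HasCompactSupport.intro (isCompact_closedBall (0 : Space n) 3) fun x hx => ?_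
  have : 3 ≤ ‖x‖ := by
    simp only [Metric.mem_closedBall, dist_zero_right, not_le] at hx
    exact hx.le
  simp [radialExtension, radialBump_eq_zero (Or.inr this)]

theorem contDiff_radialExtension {Y : Space n → Space n} (hY : ContDiff ℝ 1 Y) :
    ContDiff ℝ 1 (radialExtension Y) := by
  rw [contDiff_iff_contDiffAt]
  intro x
  rcases eq_or_ne x 0 with rfl | hx
  · have : radialExtension Y =ᶠ[nhds 0] fun _ => 0 := by
      filter_upwards [Metric.ball_mem_nhds (0 : Space n) one_pos] with y hy
      simp only [Metric.mem_ball, dist_zero_right] at hy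
      simp [radialExtension, radialBump_eq_zero (Or.inl hy.le)]
    exact contDiffAt_const.congr_of_eventuallyEq this
  · have hnorm : ContDiffAt ℝ 1 (fun x : Space n => ‖x‖) x := contDiffAt_norm ℝ hx
    have hb : ContDiffAt ℝ 1 (fun x : Space n => radialBump ‖x‖) x :=
      (radialBump.contDiff (n := 1)).contDiffAt.comp x hnorm
    have hinv : ContDiffAt ℝ 1 (fun x : Space n => ‖x‖⁻¹ • x) x :=
      (hnorm.inv (norm_ne_zero_iff.2 hx)).smul contDiffAt_id
    exact (hnorm.mul hb).smul (hY.contDiffAt.comp x hinv)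

theorem hasFDerivAt_norm_of_ne {x : Space n} (hx : x ≠ 0) :
    HasFDerivAt (fun x : Space n => ‖x‖) (‖x‖⁻¹ • innerSL ℝ x) x := by
  have h := (hasStrictFDerivAt_norm_sq x).hasFDerivAt.sqrt (by simpa using hx)
  simp only [Real.sqrt_sq (norm_nonneg _)] at h
  have e : (1 / (2 * ‖x‖)) • 2 • innerSL ℝ x = ‖x‖⁻¹ • innerSL ℝ x := by
    rw [two_nsmul, ← two_smul ℝ, smul_smul]
    congr 1
    field_simp
  exact e ▸ h

/-- The factor `‖x‖` in the extension cancels the `1 / r` from differentiating `x / ‖x‖`.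
Differentiating the radial factor adds a rank-one term of trace proportional to `⟨Y u, u⟩ = 0`, so
the divergence separates into radial and spherical parts. -/
theorem trace_fderiv_radialExtension {Y : Space n → Space n} (hY : ContDiff ℝ 1 Y)
    (ht : ∀ x : Sph n, inner ℝ (Y x) (x : Space n) = 0) (u : Sph n) {r : ℝ} (hr : 0 < r) :
    LinearMap.trace ℝ (Space n)
      (fderiv ℝ (radialExtension Y) (r • (u : Space n)) : Space n →ₗ[ℝ] Space n) =
      radialBump r * sphereDiv Y u := by
  set x : Space n := r • (u : Space n) with hx
  have hu : ‖(u : Space n)‖ = 1 := by simp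
  have hxn : ‖x‖ = r := by rw [hx, norm_smul, hu, mul_one, Real.norm_of_nonneg hr.le]
  have hx0 : x ≠ 0 := norm_ne_zero_iff.1 (by rw [hxn]; exact hr.ne')
  have hxu : ‖x‖⁻¹ • x = u := by rw [hxn, hx, smul_smul, inv_mul_cancel₀ hr.ne', one_smul]
  have hnorm : HasFDerivAt (fun x : Space n => ‖x‖) (innerSL ℝ (u : Space n)) x := by
    have := hasFDerivAt_norm_of_ne hx0
    rwa [← map_smul, hxu] at this
  have hη : HasFDerivAt (fun x : Space n => ‖x‖ * radialBump ‖x‖)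
      (deriv (fun r => r * radialBump r) r • innerSL ℝ (u : Space n)) x := by
    have hd : HasDerivAt (fun r => r * radialBump r) (deriv (fun r => r * radialBump r) r) ‖x‖ := by
      rw [hxn]
      refine DifferentiableAt.hasDerivAt ?_
      exact differentiableAt_id.mul
        ((radialBump.contDiff (n := 1)).differentiable (by simp) r)
    exact hd.comp_hasFDerivAt x hnorm
  have hinv : HasFDerivAt (fun x : Space n => ‖x‖⁻¹)
      (-(r ^ 2)⁻¹ • innerSL ℝ (u : Space n)) x := by
    have := (hasDerivAt_inv (norm_ne_zero_iff.2 hx0)).comp_hasFDerivAt x hnorm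
    rw [hxn] at this
    exact this
  have hπ : HasFDerivAt (fun x : Space n => ‖x‖⁻¹ • x) _ x := hinv.smul (hasFDerivAt_id x)
  have hYd : HasFDerivAt Y (fderiv ℝ Y u) ((fun x : Space n => ‖x‖⁻¹ • x) x) := by
    change HasFDerivAt Y (fderiv ℝ Y u) (‖x‖⁻¹ • x)
    rw [hxu]
    exact (hY.differentiable (by simp) _).hasFDerivAt
  have htot := hη.smul (HasFDerivAt.comp (g := Y) (f := fun x : Space n => ‖x‖⁻¹ • x) x hYd hπ)
  have hfd : fderiv ℝ (radialExtension Y) x = _ := htot.fderiv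
  have hlin : (fderiv ℝ (radialExtension Y) x : Space n →ₗ[ℝ] Space n) =
      radialBump r • ((fderiv ℝ Y u : Space n →ₗ[ℝ] Space n) -
        (innerₗ (Space n) (u : Space n)).smulRight (fderiv ℝ Y u u)) +
      deriv (fun r => r * radialBump r) r • (innerₗ (Space n) (u : Space n)).smulRight (Y u) := by
    ext1 v
    rw [hfd]
    simp only [ContinuousLinearMap.coe_coe, add_apply,
      smul_apply, ContinuousLinearMap.smulRight_apply, LinearMap.add_apply,
      LinearMap.smul_apply, LinearMap.sub_apply, LinearMap.smulRight_apply, Function.comp,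
      ContinuousLinearMap.comp_apply, map_add, map_smul, hxn, innerSL_apply_apply,
      innerₗ_apply_apply, ContinuousLinearMap.id_apply]
    rw [hx, map_smul]
    simp only [smul_add, smul_sub, smul_smul, smul_eq_mul]
    have e1 : r * radialBump r * r⁻¹ = radialBump r := by field_simp
    have e2 : r * radialBump r * (-(r ^ 2)⁻¹ * inner ℝ (u : Space n) v * r) =
        - (radialBump r * inner ℝ (u : Space n) v) := by field_simp
    rw [e1, e2, neg_smul, inv_mul_cancel₀ hr.ne', one_smul]
    abel
  rw [hlin, map_add, map_smul, map_smul, map_sub, LinearMap.trace_smulRight,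
    LinearMap.trace_smulRight, innerₗ_apply_apply, innerₗ_apply_apply, sphereDiv,
    real_inner_comm (Y u), ht, real_inner_comm (fderiv ℝ Y u u)]
  simp

/-- The divergence theorem on the sphere. -/
theorem integral_sphereDiv_eq_zero {Y : Space n → Space n} (hY : ContDiff ℝ 1 Y)
    (ht : ∀ x : Sph n, inner ℝ (Y x) (x : Space n) = 0) :
    ∫ x, sphereDiv Y x ∂(surf n) = 0 := by
  have h1 := integral_trace_fderiv_eq_zero (contDiff_radialExtension hY)
    (hasCompactSupport_radialExtension Y)
  rw [integral_eq_radial_mul_spherical (a := radialBump) (g := sphereDiv Y)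
    fun u r hr => trace_fderiv_radialExtension hY ht u hr] at h1
  refine (mul_eq_zero.1 h1).resolve_left fun h0 => ?_
  -- The radial integral is nonzero because the same polar formula expresses the positive integral
  -- of `radialBump ‖x‖` through it.
  have h2 := integral_eq_radial_mul_spherical (n := n) (F := fun x => radialBump ‖x‖)
    (a := radialBump) (g := fun _ => 1) (fun u r hr => by
      rw [norm_smul, Real.norm_of_nonneg hr.le]; simp)
  rw [h0, zero_mul] at h2
  have hpos : 0 < ∫ x : Space n, radialBump ‖x‖ := by
    refine Continuous.integral_pos_of_hasCompactSupport_nonneg_nonzero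
      (x := EuclideanSpace.single 0 2)
      (radialBump.continuous.comp continuous_norm) ?_ (fun x => radialBump.nonneg) ?_
    · refine HasCompactSupport.intro (isCompact_closedBall (0 : Space n) 3) fun x hx => ?_
      simp only [Metric.mem_closedBall, dist_zero_right, not_le] at hx
      exact radialBump_eq_zero (Or.inr hx.le)
    · have : ‖(EuclideanSpace.single 0 2 : Space n)‖ = 2 := by simp
      rw [this, radialBump.one_of_mem_closedBall]
      · exact one_ne_zero
      · simp [radialBump]
  exact hpos.ne' h2

end Divergence

/-! ### Harmonic polynomials as eigenfunctions on the sphere -/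

section SphericalHarmonics

open MvPolynomial

variable {n : ℕ}

/-- The gradient of a polynomial. -/
def polyGrad (p : MvPolynomial (Fin (n + 1)) ℝ) (x : Space n) : Space n :=
  WithLp.toLp 2 fun i => pEval (pderiv i p) x

/-- The tangential part of the gradient, along the unit sphere, of a homogeneous polynomial of
degree `k`. -/
def tanGrad (k : ℕ) (p : MvPolynomial (Fin (n + 1)) ℝ) (x : Space n) : Space n :=
  polyGrad p x - (k * pEval p x) • x

/-- The eigenvalue of the Laplacian on the sphere for the spherical harmonics of degree `k`. -/
def eigenvalue (n k : ℕ) : ℝ := k * (k + n - 1)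

theorem inner_polyGrad (p : MvPolynomial (Fin (n + 1)) ℝ) (x v : Space n) :
    inner ℝ (polyGrad p x) v = ∑ i, v i * pEval (pderiv i p) x := by
  simp [PiLp.inner_apply, polyGrad]

theorem contDiff_pEval (m : WithTop ℕ∞) (p : MvPolynomial (Fin (n + 1)) ℝ) :
    ContDiff ℝ m (pEval p) := by
  induction p using MvPolynomial.induction_on with
  | C a =>
    have : pEval (C a) = fun _ : Space n => a := by ext x; simp [pEval]
    rw [this]; exact contDiff_const
  | add p q hp hq =>
    have : pEval (p + q) = fun x : Space n => pEval p x + pEval q x := by ext x; simp [pEval]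
    rw [this]; exact hp.add hq
  | mul_X p i hp =>
    have : pEval (p * X i) = fun x : Space n => pEval p x * x i := by ext x; simp [pEval]
    rw [this]; exact hp.mul (by fun_prop)

theorem hasFDerivAt_pEval (p : MvPolynomial (Fin (n + 1)) ℝ) (x : Space n) :
    HasFDerivAt (pEval p) (innerSL ℝ (polyGrad p x)) x := by
  induction p using MvPolynomial.induction_on with
  | C a =>
    have h1 : pEval (C a) = fun _ : Space n => a := by ext x; simp [pEval]
    have h2 : polyGrad (C a) x = 0 := by ext i; simp [polyGrad, pEval]
    rw [h1, h2, map_zero]; exact hasFDerivAt_const _ _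
  | add p q hp hq =>
    have h1 : pEval (p + q) = fun x : Space n => pEval p x + pEval q x := by ext x; simp [pEval]
    have h2 : polyGrad (p + q) x = polyGrad p x + polyGrad q x := by
      ext i; simp [polyGrad, pEval]
    rw [h1, h2, map_add]; exact hp.add hq
  | mul_X p i hp =>
    have h1 : pEval (p * X i) = fun x : Space n => pEval p x * x i := by ext x; simp [pEval]
    have h3 : HasFDerivAt (fun x : Space n => x i) (EuclideanSpace.proj i : Space n →L[ℝ] ℝ) x :=
      (EuclideanSpace.proj i : Space n →L[ℝ] ℝ).hasFDerivAt
    have h2 : innerSL ℝ (polyGrad (p * X i) x) =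
        pEval p x • (EuclideanSpace.proj i : Space n →L[ℝ] ℝ) + x i • innerSL ℝ (polyGrad p x) := by
      ext v
      simp only [innerSL_apply_apply, inner_polyGrad, add_apply, smul_apply, Derivation.leibniz,
        pderiv_X, smul_eq_mul]
      simp [pEval, mul_add, Finset.sum_add_distrib, Pi.single_apply, Finset.mul_sum, apply_ite]
      congr 1
      · ring
      · exact Finset.sum_congr rfl fun j _ => by ring
    rw [h1, h2]
    exact hp.mul h3

theorem contDiff_polyGrad (m : WithTop ℕ∞) (p : MvPolynomial (Fin (n + 1)) ℝ) :
    ContDiff ℝ m (polyGrad p) :=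
  contDiff_euclidean.2 fun i => contDiff_pEval m (pderiv i p)

theorem contDiff_tanGrad (m : WithTop ℕ∞) (k : ℕ) (p : MvPolynomial (Fin (n + 1)) ℝ) :
    ContDiff ℝ m (tanGrad k p) :=
  (contDiff_polyGrad m p).sub ((contDiff_const.mul (contDiff_pEval m p)).smul contDiff_id)

theorem fderiv_polyGrad_apply (p : MvPolynomial (Fin (n + 1)) ℝ) (x v : Space n) (i : Fin (n + 1)) :
    (fderiv ℝ (polyGrad p) x v) i = inner ℝ (polyGrad (pderiv i p) x) v := by
  have h1 : HasFDerivAt (polyGrad p) (fderiv ℝ (polyGrad p) x) x :=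
    ((contDiff_polyGrad 1 p).differentiable (by simp) x).hasFDerivAt
  have h2 := ((EuclideanSpace.proj i : Space n →L[ℝ] ℝ).hasFDerivAt).comp x h1
  have h3 := h2.unique (hasFDerivAt_pEval (pderiv i p) x)
  simpa using congrArg (fun L : Space n →L[ℝ] ℝ => L v) h3

theorem inner_polyGrad_self {k : ℕ} {p : MvPolynomial (Fin (n + 1)) ℝ} (hp : p.IsHomogeneous k)
    (x : Space n) : inner ℝ (polyGrad p x) x = k * pEval p x := by
  rw [inner_polyGrad]
  have := congrArg (fun r => pEval r x) hp.sum_X_mul_pderiv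
  simpa [pEval] using this

theorem inner_tanGrad {k : ℕ} (p : MvPolynomial (Fin (n + 1)) ℝ) {x v : Space n}
    (hv : inner ℝ v x = 0) : inner ℝ (tanGrad k p x) v = inner ℝ (polyGrad p x) v := by
  rw [tanGrad, inner_sub_left, real_inner_smul_left, real_inner_comm v x, hv]
  simp

theorem isTangentField_tanGrad {k : ℕ} {p : MvPolynomial (Fin (n + 1)) ℝ}
    (hp : p.IsHomogeneous k) : IsTangentField (tanGrad k p) := by
  refine ⟨contDiff_tanGrad _ k p, fun x => ?_⟩
  rw [tanGrad, inner_sub_left, real_inner_smul_left, inner_polyGrad_self hp, inner_self_sph]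
  ring

theorem fderiv_tanGrad_apply (k : ℕ) (p : MvPolynomial (Fin (n + 1)) ℝ) (x v : Space n) :
    fderiv ℝ (tanGrad k p) x v = fderiv ℝ (polyGrad p) x v
      - ((k * pEval p x) • v + (k * inner ℝ (polyGrad p x) v) • x) := by
  have h1 : HasFDerivAt (polyGrad p) (fderiv ℝ (polyGrad p) x) x :=
    ((contDiff_polyGrad 1 p).differentiable (by simp) x).hasFDerivAt
  have h2 := h1.sub (((hasFDerivAt_pEval p x).const_mul (k : ℝ)).smul (hasFDerivAt_id x))
  have h3 : fderiv ℝ (tanGrad k p) x = _ := h2.fderiv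
  rw [h3]
  simp

/-- The Hessian of `p` has trace zero by harmonicity, and Euler's identity, applied to `p` and to
its partial derivatives, evaluates the radial terms. -/
theorem sphereDiv_tanGrad {k : ℕ} {p : MvPolynomial (Fin (n + 1)) ℝ} (hp : p.IsHomogeneous k)
    (hl : lap (n + 1) p = 0) (x : Sph n) :
    sphereDiv (tanGrad k p) x = - eigenvalue n k * pEval p x := by
  have hlin : (fderiv ℝ (tanGrad k p) (x : Space n) : Space n →ₗ[ℝ] Space n) =
      (fderiv ℝ (polyGrad p) (x : Space n) : Space n →ₗ[ℝ] Space n)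
      - ((k * pEval p x) • LinearMap.id + (k : ℝ) •
        (innerₗ (Space n) (polyGrad p x)).smulRight (x : Space n)) := by
    ext1 v
    simp [fderiv_tanGrad_apply, smul_smul]
  have htr : LinearMap.trace ℝ (Space n)
      (fderiv ℝ (polyGrad p) (x : Space n) : Space n →ₗ[ℝ] Space n) = 0 := by
    rw [LinearMap.trace_eq_sum_inner _ (EuclideanSpace.basisFun (Fin (n + 1)) ℝ)]
    simp only [EuclideanSpace.basisFun_apply, EuclideanSpace.inner_single_left,
      ContinuousLinearMap.coe_coe, fderiv_polyGrad_apply, EuclideanSpace.inner_single_right]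
    rw [lap_apply] at hl
    simpa [polyGrad, pEval] using congrArg (fun r => pEval r (x : Space n)) hl
  have hxx : inner ℝ (fderiv ℝ (polyGrad p) (x : Space n) x) (x : Space n) =
      (k * (k - 1)) * pEval p x := by
    have h1 : ∀ i, inner ℝ (polyGrad (pderiv i p) (x : Space n)) (x : Space n) =
        (k - 1 : ℕ) * pEval (pderiv i p) x := fun i => inner_polyGrad_self hp.pderiv _
    simp only [PiLp.inner_apply, fderiv_polyGrad_apply, h1]
    have h2 := inner_polyGrad_self hp (x : Space n)
    rw [inner_polyGrad] at h2
    have h3 : ((k - 1 : ℕ) : ℝ) * ∑ i, (x : Space n) i * pEval (pderiv i p) (x : Space n) =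
        (k * (k - 1)) * pEval p x := by
      rw [h2]
      -- For `k = 0` the subtraction `k - 1` is truncated, but the factor `k` kills the term.
      rcases k with _ | k
      · simp
      · push_cast [Nat.add_sub_cancel]; ring
    rw [← h3, Finset.mul_sum]
    refine Finset.sum_congr rfl fun i _ => ?_
    simp
    ring
  rw [sphereDiv, hlin, map_sub, map_add, map_smul, map_smul, LinearMap.trace_smulRight,
    LinearMap.trace_id, htr, innerₗ_apply_apply, inner_polyGrad_self hp, fderiv_tanGrad_apply,
    inner_sub_left, inner_add_left, real_inner_smul_left, real_inner_smul_left, inner_self_sph,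
    hxx, inner_polyGrad_self hp, eigenvalue]
  simp
  ring

theorem sphereDiv_pEval_smul (p : MvPolynomial (Fin (n + 1)) ℝ) {X : Space n → Space n}
    (hX : IsTangentField X) (x : Sph n) :
    sphereDiv (fun y => pEval p y • X y) x =
      pEval p x * sphereDiv X x + inner ℝ (polyGrad p x) (X x) := by
  have h1 : HasFDerivAt X (fderiv ℝ X x) (x : Space n) :=
    (hX.1.differentiable (by simp) _).hasFDerivAt
  have h2 : fderiv ℝ (fun y => pEval p y • X y) (x : Space n) = _ :=
    ((hasFDerivAt_pEval p (x : Space n)).smul h1).fderiv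
  have hlin : (fderiv ℝ (fun y => pEval p y • X y) (x : Space n) : Space n →ₗ[ℝ] Space n) =
      pEval p x • (fderiv ℝ X x : Space n →ₗ[ℝ] Space n) +
        (innerₗ (Space n) (polyGrad p x)).smulRight (X x) := by
    rw [h2]; ext1 v; simp
  rw [sphereDiv, hlin, h2, map_add, map_smul, LinearMap.trace_smulRight, innerₗ_apply_apply,
    sphereDiv]
  simp [inner_add_left, real_inner_smul_left, hX.2 x]
  ring

theorem continuous_sphereDiv {X : Space n → Space n} (hX : ContDiff ℝ 1 X) :
    Continuous (sphereDiv X) := by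
  have h1 : Continuous fun x : Sph n => fderiv ℝ X x :=
    (hX.continuous_fderiv (by simp)).comp continuous_subtype_val
  have h2 : sphereDiv X = fun x : Sph n => ∑ i, inner ℝ (EuclideanSpace.basisFun (Fin (n + 1)) ℝ i)
      (fderiv ℝ X x (EuclideanSpace.basisFun (Fin (n + 1)) ℝ i)) -
        inner ℝ (fderiv ℝ X x (x : Space n)) (x : Space n) := by
    ext x
    rw [sphereDiv, LinearMap.trace_eq_sum_inner _ (EuclideanSpace.basisFun (Fin (n + 1)) ℝ)]
    rfl
  rw [h2]
  exact (continuous_finsetSum _ fun i _ => continuous_const.inner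
    (h1.clm_apply continuous_const)).sub
      ((h1.clm_apply continuous_subtype_val).inner continuous_subtype_val)

theorem integrable_of_continuous {f : Sph n → ℝ} (hf : Continuous f) : Integrable f (surf n) :=
  hf.integrable_of_hasCompactSupport (HasCompactSupport.of_compactSpace f)

theorem memLp_of_continuous {E : Type*} [NormedAddCommGroup E] [SecondCountableTopology E]
    {f : Sph n → E} (hf : Continuous f) :
    MemLp f 2 (surf n) := by
  obtain ⟨C, hC⟩ := isCompact_univ.exists_bound_of_continuousOn hf.continuousOn
  exact MemLp.of_bound hf.aestronglyMeasurable C (.of_forall fun x => hC x trivial)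

theorem continuous_pEval_sph (p : MvPolynomial (Fin (n + 1)) ℝ) :
    Continuous fun x : Sph n => pEval p x :=
  (contDiff_pEval 0 p).continuous.comp continuous_subtype_val

theorem continuous_tanGrad_sph (k : ℕ) (p : MvPolynomial (Fin (n + 1)) ℝ) :
    Continuous fun x : Sph n => tanGrad k p x :=
  (contDiff_tanGrad 0 k p).continuous.comp continuous_subtype_val

theorem integral_pEval_mul_sphereDiv (k : ℕ) (p : MvPolynomial (Fin (n + 1)) ℝ)
    {X : Space n → Space n} (hX : IsTangentField X) :
    ∫ x, pEval p (x : Space n) * sphereDiv X x ∂(surf n) =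
      - ∫ x, inner ℝ (tanGrad k p (x : Space n)) (X x) ∂(surf n) := by
  have hX1 : ContDiff ℝ 1 X := hX.1.of_le (by simp)
  have h0 := integral_sphereDiv_eq_zero (n := n) ((contDiff_pEval 1 p).smul hX1)
    (fun x => by simp [real_inner_smul_left, hX.2 x])
  have h1 : ∀ x : Sph n, sphereDiv (pEval p • X) x =
      pEval p x * sphereDiv X x + inner ℝ (tanGrad k p x) (X x) := fun x => by
    rw [inner_tanGrad p (hX.2 x)]; exact sphereDiv_pEval_smul p hX x
  simp only [h1] at h0
  rw [integral_add] at h0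
  · linarith
  · exact integrable_of_continuous ((continuous_pEval_sph p).mul (continuous_sphereDiv hX1))
  · exact integrable_of_continuous ((continuous_tanGrad_sph k p).inner
      (hX1.continuous.comp continuous_subtype_val))

theorem isWeakGradient_tanGrad {k : ℕ} {p : MvPolynomial (Fin (n + 1)) ℝ}
    (hp : p.IsHomogeneous k) :
    IsWeakGradient (fun x : Sph n => pEval p x) (fun x => tanGrad k p x) where
  memLp := memLp_of_continuous (continuous_tanGrad_sph k p)
  tangent := .of_forall (isTangentField_tanGrad hp).2
  integral_by_parts _ hX := integral_pEval_mul_sphereDiv k p hX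

/-- The tangential gradient of `p` is itself an admissible test field; this is the only way the weak
gradient enters the Poincaré estimate. -/
theorem integral_inner_weakGradient_tanGrad {ξ : Sph n → ℝ} {G : Sph n → Space n}
    (hG : IsWeakGradient ξ G) {k : ℕ} {p : MvPolynomial (Fin (n + 1)) ℝ} (hp : p.IsHomogeneous k)
    (hl : lap (n + 1) p = 0) :
    ∫ x, inner ℝ (G x) (tanGrad k p (x : Space n)) ∂(surf n) =
      eigenvalue n k * ∫ x, ξ x * pEval p (x : Space n) ∂(surf n) := by
  have h := hG.integral_by_parts _ (isTangentField_tanGrad hp)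
  simp only [sphereDiv_tanGrad hp hl] at h
  rw [← neg_eq_iff_eq_neg.2 h, ← integral_const_mul, ← integral_neg]
  exact integral_congr_ae (.of_forall fun x => by ring)

theorem eigenvalue_strictMono (hn : 1 ≤ n) : StrictMono (eigenvalue n) := by
  have hn' : (1 : ℝ) ≤ n := by exact_mod_cast hn
  refine strictMono_nat_of_lt_succ fun k => ?_
  have : (0 : ℝ) ≤ k := k.cast_nonneg
  simp only [eigenvalue]
  push_cast
  nlinarith

theorem eigenvalue_nonneg (hn : 1 ≤ n) (k : ℕ) : 0 ≤ eigenvalue n k := by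
  have := (eigenvalue_strictMono hn).monotone (Nat.zero_le k)
  simpa [eigenvalue] using this

/-- The Dirichlet pairing is symmetric, so it equals the `L²` pairing times either of two distinct
eigenvalues. -/
theorem integral_mul_eq_zero_of_ne (hn : 1 ≤ n) {k m : ℕ} (hkm : k ≠ m)
    {p r : MvPolynomial (Fin (n + 1)) ℝ} (hp : p.IsHomogeneous k) (hpl : lap (n + 1) p = 0)
    (hr : r.IsHomogeneous m) (hrl : lap (n + 1) r = 0) :
    ∫ x, pEval p (x : Space n) * pEval r (x : Space n) ∂(surf n) = 0 := by
  have h1 := integral_inner_weakGradient_tanGrad (isWeakGradient_tanGrad hp) hr hrl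
  have h2 := integral_inner_weakGradient_tanGrad (isWeakGradient_tanGrad hr) hp hpl
  simp only [real_inner_comm (tanGrad m r _), mul_comm (pEval r _)] at h1 h2
  rw [h1] at h2
  have h3 : eigenvalue n m ≠ eigenvalue n k := (eigenvalue_strictMono hn).injective.ne hkm.symm
  exact (mul_eq_mul_right_iff.1 h2).resolve_left h3

end SphericalHarmonics

/-! ### The Poincaré inequality for functions orthogonal to low degrees -/

section Poincare

open MvPolynomial

variable {n : ℕ} {q : Fin (n + 2) → Sph n}

theorem pEval_smul {k : ℕ} {p : MvPolynomial (Fin (n + 1)) ℝ} (hp : p.IsHomogeneous k) (r : ℝ)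
    (x : Space n) : pEval p (r • x) = r ^ k * pEval p x := by
  simp only [pEval, eval_eq', Finset.mul_sum]
  refine Finset.sum_congr rfl fun d hd => ?_
  have h := hp (mem_support_iff.1 hd)
  have h2 : ∑ i, d i = k := by
    rw [← h, Finsupp.weight_apply, Finsupp.sum_fintype _ _ (by simp)]
    simp
  simp only [PiLp.smul_apply, smul_eq_mul, mul_pow, Finset.prod_mul_distrib,
    Finset.prod_pow_eq_pow_sum, h2]
  ring

theorem eq_zero_of_forall_sph {k : ℕ} {p : MvPolynomial (Fin (n + 1)) ℝ} (hp : p.IsHomogeneous k)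
    (h : ∀ x : Sph n, pEval p x = 0) : p = 0 := by
  have h1 : ∀ x : Space n, x ≠ 0 → pEval p x = 0 := by
    intro x hx
    have hx' := norm_ne_zero_iff.2 hx
    have hu : ‖x‖⁻¹ • x ∈ Metric.sphere (0 : Space n) 1 := by simp [norm_smul, hx']
    have h2 := pEval_smul hp ‖x‖ (‖x‖⁻¹ • x)
    rw [h ⟨_, hu⟩, smul_smul, mul_inv_cancel₀ hx', one_smul, mul_zero] at h2
    exact h2
  have h2 : pEval p = fun _ => (0 : ℝ) :=
    (contDiff_pEval 0 p).continuous.ext_on (dense_compl_singleton (0 : Space n)) continuous_const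
      fun x hx => h1 x hx
  refine MvPolynomial.funext fun y => ?_
  simpa [pEval] using congrFun h2 (WithLp.toLp 2 y)

theorem integral_sq_pos {k : ℕ} {p : MvPolynomial (Fin (n + 1)) ℝ} (hp : p.IsHomogeneous k)
    (h0 : p ≠ 0) : 0 < ∫ x, pEval p (x : Space n) ^ 2 ∂(surf n) := by
  have : ∃ x : Sph n, pEval p x ≠ 0 := by
    by_contra! h
    exact h0 (eq_zero_of_forall_sph hp h)
  obtain ⟨x, hx⟩ := this
  have hc := (continuous_pEval_sph p).pow 2
  exact hc.integral_pos_of_hasCompactSupport_nonneg_nonzero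
    (HasCompactSupport.of_compactSpace _) (fun x => sq_nonneg _) (pow_ne_zero 2 hx)

theorem integrable_inner_of_memLp {α E : Type*} [MeasurableSpace α] {μ : Measure α}
    [NormedAddCommGroup E] [InnerProductSpace ℝ E] {f g : α → E} (hf : MemLp f 2 μ)
    (hg : MemLp g 2 μ) : Integrable (fun x => inner ℝ (f x) (g x)) μ := by
  have h1 := (hf.norm.integrable_sq).add (hg.norm.integrable_sq)
  refine h1.mono' (hf.1.inner hg.1) (.of_forall fun x => ?_)
  refine (norm_inner_le_norm _ _).trans ?_
  simp only [Pi.add_apply]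
  nlinarith [sq_nonneg (‖f x‖ - ‖g x‖), sq_nonneg ‖f x‖, sq_nonneg ‖g x‖]

theorem integrable_mul_of_memLp {f g : Sph n → ℝ} (hf : MemLp f 2 (surf n))
    (hg : MemLp g 2 (surf n)) : Integrable (fun x => f x * g x) (surf n) := by
  simpa [mul_comm] using integrable_inner_of_memLp hf hg

theorem exists_polynomial_near {f : Sph n → ℝ} (hf : Continuous f) {ε : ℝ} (hε : 0 < ε) :
    ∃ p : MvPolynomial (Fin (n + 1)) ℝ, ∀ x : Sph n, |pEval p x - f x| < ε := by
  let c : Fin (n + 1) → C(Sph n, ℝ) := fun i => ⟨fun x => (x : Space n) i, by fun_prop⟩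
  have hc : ∀ (p : MvPolynomial (Fin (n + 1)) ℝ) (x : Sph n), aeval c p x = pEval p x := by
    intro p x
    induction p using MvPolynomial.induction_on with
    | C a => simp [pEval]
    | add p q hp hq => simp_all [pEval]
    | mul_X p i hp => simp_all [pEval, c]
  obtain ⟨⟨g, hg⟩, h⟩ :=
    ContinuousMap.exists_mem_subalgebra_near_continuous_of_separatesPoints
      (aeval (R := ℝ) c).range (fun x y hxy => by
        have : ∃ i, (x : Space n) i ≠ (y : Space n) i := by
          by_contra! h
          exact hxy (Subtype.ext (PiLp.ext h))
        obtain ⟨i, hi⟩ := this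
        exact ⟨c i, ⟨c i, ⟨X i, by simp⟩, rfl⟩, hi⟩) f hf ε hε
  obtain ⟨p, rfl⟩ := hg
  exact ⟨p, fun x => by simpa [hc] using h x⟩

theorem exists_polynomial_integral_sq_lt {ξ : Sph n → ℝ} (hξ : MemLp ξ 2 (surf n)) {ε : ℝ}
    (hε : 0 < ε) : ∃ p : MvPolynomial (Fin (n + 1)) ℝ,
      ∫ x, (ξ x - pEval p (x : Space n)) ^ 2 ∂(surf n) ≤ ε := by
  obtain ⟨g, hg, -⟩ := MemLp.exists_boundedContinuous_integral_rpow_sub_le (μ := surf n)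
    (p := 2) two_pos (f := ξ) (by simpa using hξ) (show 0 < ε / 4 by positivity)
  set M := (surf n).real Set.univ with hM
  have hM0 : 0 ≤ M := measureReal_nonneg
  -- Squared errors at most double under addition: `2 * (ε / 4)` from `g`, and at most `ε / 2` from
  -- `p` on total mass `M`. The `+ 1` avoids dividing by zero.
  obtain ⟨p, hp⟩ := exists_polynomial_near g.continuous
    (show 0 < √(ε / (4 * (M + 1))) by positivity)
  refine ⟨p, ?_⟩
  have hgL : MemLp g 2 (surf n) := memLp_of_continuous g.continuous
  have hpL : MemLp (fun x : Sph n => pEval p (x : Space n)) 2 (surf n) :=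
    memLp_of_continuous (continuous_pEval_sph p)
  have hi1 : Integrable (fun x => (ξ x - g x) ^ 2) (surf n) := (hξ.sub hgL).integrable_sq
  have hbound : ∀ x : Sph n, (ξ x - pEval p (x : Space n)) ^ 2 ≤
      2 * (ξ x - g x) ^ 2 + 2 * (ε / (4 * (M + 1))) := by
    intro x
    have h1 : (pEval p (x : Space n) - g x) ^ 2 ≤ ε / (4 * (M + 1)) := by
      rw [← sq_abs, ← Real.sq_sqrt (show 0 ≤ ε / (4 * (M + 1)) by positivity)]
      exact pow_le_pow_left₀ (abs_nonneg _) (hp x).le 2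
    nlinarith [sq_nonneg (ξ x - g x + (pEval p (x : Space n) - g x))]
  have hle := integral_mono (μ := surf n) (hξ.sub hpL).integrable_sq
    ((hi1.const_mul 2).add (integrable_const (2 * (ε / (4 * (M + 1)))))) hbound
  simp only [Pi.sub_apply, Pi.add_apply] at hle
  rw [integral_add (hi1.const_mul 2) (integrable_const _), integral_const_mul, integral_const,
    smul_eq_mul, ← hM] at hle
  have hg' : ∫ x, (ξ x - g x) ^ 2 ∂(surf n) ≤ ε / 4 := by
    refine le_of_eq_of_le (integral_congr_ae (.of_forall fun x => ?_)) hg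
    simp
  have h3 : M * (2 * (ε / (4 * (M + 1)))) ≤ ε / 2 := by
    rw [show M * (2 * (ε / (4 * (M + 1)))) = ε / 2 * (M / (M + 1)) by field_simp; ring]
    exact mul_le_of_le_one_right (by positivity) ((div_le_one (by positivity)).2 (by linarith))
  linarith

/-- A Bessel inequality: expand `0 ≤ ∫ ‖G - Y‖ ^ 2` with `Y = ∑ t k • tanGrad k (H k)`, whose terms
are mutually orthogonal. The weights `t` stay free for later choice. -/
theorem lower_bound_of_weakGradient (hn : 1 ≤ n) {ξ : Sph n → ℝ} {G : Sph n → Space n}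
    (hG : IsWeakGradient ξ G)
    {H : ℕ →₀ MvPolynomial (Fin (n + 1)) ℝ}
    (hH : ∀ k, (H k).IsHomogeneous k ∧ lap (n + 1) (H k) = 0) (t : ℕ → ℝ) :
    ∑ k ∈ H.support, eigenvalue n k *
        (2 * t k * ∫ x, ξ x * pEval (H k) (x : Space n) ∂(surf n)
          - t k ^ 2 * ∫ x, pEval (H k) (x : Space n) ^ 2 ∂(surf n)) ≤
      ∫ x, ‖G x‖ ^ 2 ∂(surf n) := by
  set Y : Sph n → Space n := fun x => ∑ k ∈ H.support, t k • tanGrad k (H k) (x : Space n) with hY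
  have hYc : Continuous Y :=
    continuous_finsetSum _ fun k _ => (continuous_tanGrad_sph k (H k)).const_smul (t k)
  have hYL : MemLp Y 2 (surf n) := memLp_of_continuous hYc
  have hXL : ∀ k, MemLp (fun x : Sph n => tanGrad k (H k) (x : Space n)) 2 (surf n) := fun k =>
    memLp_of_continuous (continuous_tanGrad_sph k (H k))
  have hsum : ∀ F : Sph n → Space n, MemLp F 2 (surf n) → ∫ x, inner ℝ (F x) (Y x) ∂(surf n) =
      ∑ k ∈ H.support, t k * ∫ x, inner ℝ (F x) (tanGrad k (H k) (x : Space n)) ∂(surf n) := by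
    intro F hF
    simp only [hY, inner_sum, real_inner_smul_right]
    rw [integral_finsetSum _ fun k _ => (integrable_inner_of_memLp hF (hXL k)).const_mul _]
    simp only [integral_const_mul]
  have hGY : ∫ x, inner ℝ (G x) (Y x) ∂(surf n) = ∑ k ∈ H.support, eigenvalue n k *
      (t k * ∫ x, ξ x * pEval (H k) (x : Space n) ∂(surf n)) := by
    rw [hsum G hG.memLp]
    refine Finset.sum_congr rfl fun k _ => ?_
    rw [integral_inner_weakGradient_tanGrad hG (hH k).1 (hH k).2]
    ring
  have hYY : ∫ x, inner ℝ (Y x) (Y x) ∂(surf n) = ∑ k ∈ H.support, eigenvalue n k *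
      (t k ^ 2 * ∫ x, pEval (H k) (x : Space n) ^ 2 ∂(surf n)) := by
    rw [hsum Y hYL]
    refine Finset.sum_congr rfl fun k hk => ?_
    simp only [real_inner_comm (tanGrad k _ _)]
    rw [show (∫ x, inner ℝ (tanGrad k (H k) (x : Space n)) (Y x) ∂(surf n)) = _ from
      hsum _ (hXL k), Finset.sum_eq_single k]
    · rw [integral_inner_weakGradient_tanGrad (isWeakGradient_tanGrad (hH k).1) (hH k).1 (hH k).2]
      simp only [← sq]
      ring
    · intro m _ hmk
      rw [integral_inner_weakGradient_tanGrad (isWeakGradient_tanGrad (hH k).1) (hH m).1 (hH m).2,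
        integral_mul_eq_zero_of_ne hn hmk.symm (hH k).1 (hH k).2 (hH m).1 (hH m).2]
      simp
    · exact fun h => absurd hk h
  have hpos : 0 ≤ ∫ x, ‖G x - Y x‖ ^ 2 ∂(surf n) := integral_nonneg fun x => sq_nonneg _
  have hexp : ∫ x, ‖G x - Y x‖ ^ 2 ∂(surf n) = ∫ x, ‖G x‖ ^ 2 ∂(surf n)
      - 2 * ∫ x, inner ℝ (G x) (Y x) ∂(surf n) + ∫ x, inner ℝ (Y x) (Y x) ∂(surf n) := by
    simp only [norm_sub_sq_real, ← real_inner_self_eq_norm_sq (Y _)]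
    have i1 : Integrable (fun x => ‖G x‖ ^ 2) (surf n) := hG.memLp.norm.integrable_sq
    have i2 := (integrable_inner_of_memLp hG.memLp hYL).const_mul 2
    have i3 : Integrable (fun x => ‖G x‖ ^ 2 - 2 * inner ℝ (G x) (Y x)) (surf n) := i1.sub i2
    rw [integral_add i3 (integrable_inner_of_memLp hYL hYL), integral_sub i1 i2,
      integral_const_mul]
  rw [hexp, hGY, hYY] at hpos
  have : ∑ k ∈ H.support, eigenvalue n k *
        (2 * t k * ∫ x, ξ x * pEval (H k) (x : Space n) ∂(surf n)
          - t k ^ 2 * ∫ x, pEval (H k) (x : Space n) ^ 2 ∂(surf n)) =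
      2 * (∑ k ∈ H.support, eigenvalue n k *
        (t k * ∫ x, ξ x * pEval (H k) (x : Space n) ∂(surf n))) -
      ∑ k ∈ H.support, eigenvalue n k *
        (t k ^ 2 * ∫ x, pEval (H k) (x : Space n) ^ 2 ∂(surf n)) := by
    rw [Finset.mul_sum, ← Finset.sum_sub_distrib]
    exact Finset.sum_congr rfl fun k _ => by ring
  linarith

/-- A function that is orthogonal to the spherical harmonics of degree less than `K` satisfies
the Poincaré inequality with the constant `eigenvalue n K`. -/
theorem poincare_of_orthogonal (hn : 1 ≤ n) (K : ℕ) {ξ : Sph n → ℝ} {G : Sph n → Space n}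
    (hξ : MemLp ξ 2 (surf n)) (hG : IsWeakGradient ξ G)
    (horth : ∀ k < K, ∀ p : MvPolynomial (Fin (n + 1)) ℝ, p.IsHomogeneous k →
      lap (n + 1) p = 0 → ∫ x, ξ x * pEval p (x : Space n) ∂(surf n) = 0) :
    eigenvalue n K * ∫ x, ξ x ^ 2 ∂(surf n) ≤ ∫ x, ‖G x‖ ^ 2 ∂(surf n) := by
  have hΛ := eigenvalue_nonneg hn K
  refine le_of_forall_pos_le_add fun ε hε => ?_
  obtain ⟨p, hp⟩ := exists_polynomial_integral_sq_lt hξ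
    (show 0 < ε / (eigenvalue n K + 1) by positivity)
  obtain ⟨H, hH, hpH⟩ := exists_harmonic_decomposition p
  set a : ℕ → ℝ := fun k => ∫ x, ξ x * pEval (H k) (x : Space n) ∂(surf n) with ha
  set b : ℕ → ℝ := fun k => ∫ x, pEval (H k) (x : Space n) ^ 2 ∂(surf n) with hb
  have hb0 : ∀ k, 0 ≤ b k := fun k => integral_nonneg fun x => sq_nonneg _
  -- The sum of `2 * a k - b k` is `∫ ξ ^ 2` minus the approximation error. Keeping only nonnegative
  -- terms lets each eigenvalue be replaced by that of degree `K`: for `k < K` orthogonality gives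
  -- `a k = 0`, so a kept term is zero.
  have h1 := lower_bound_of_weakGradient hn hG hH (fun k => if 0 ≤ 2 * a k - b k then 1 else 0)
  have h2 : eigenvalue n K * ∑ k ∈ H.support, (2 * a k - b k) ≤ ∫ x, ‖G x‖ ^ 2 ∂(surf n) := by
    refine le_trans ?_ h1
    rw [Finset.mul_sum]
    refine Finset.sum_le_sum fun k _ => ?_
    change _ ≤ eigenvalue n k * (2 * _ * a k - _ * b k)
    split_ifs with h
    · rcases lt_or_ge k K with hk | hk
      · have hak : a k = 0 := horth k hk _ (hH k).1 (hH k).2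
        have hbk : b k = 0 := le_antisymm (by rw [hak] at h; linarith) (hb0 k)
        simp [hak, hbk]
      · have := mul_le_mul_of_nonneg_right ((eigenvalue_strictMono hn).monotone hk) h
        simpa using this
    · have := mul_nonpos_of_nonneg_of_nonpos hΛ (not_le.1 h).le
      simpa using this
  have hL : ∀ r : MvPolynomial (Fin (n + 1)) ℝ,
      MemLp (fun x : Sph n => pEval r (x : Space n)) 2 (surf n) := fun r =>
    memLp_of_continuous (continuous_pEval_sph r)
  have hsum : ∀ F : Sph n → ℝ, MemLp F 2 (surf n) → ∫ x, F x * pEval p (x : Space n) ∂(surf n) =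
      ∑ k ∈ H.support, ∫ x, F x * pEval (H k) (x : Space n) ∂(surf n) := by
    intro F hF
    simp only [hpH, Finsupp.sum, Finset.mul_sum]
    rw [integral_finsetSum _ fun k _ => integrable_mul_of_memLp hF (hL _)]
  have h3 : ∫ x, pEval p (x : Space n) ^ 2 ∂(surf n) = ∑ k ∈ H.support, b k := by
    simp only [sq]
    rw [hsum _ (hL p)]
    refine Finset.sum_congr rfl fun k hk => ?_
    simp only [mul_comm (pEval p _)]
    rw [hsum _ (hL _), Finset.sum_eq_single k]
    · simp only [hb, sq]
    · exact fun m _ hmk => integral_mul_eq_zero_of_ne hn hmk.symm (hH k).1 (hH k).2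
        (hH m).1 (hH m).2
    · exact fun h => absurd hk h
  have h4 : ∫ x, (ξ x - pEval p (x : Space n)) ^ 2 ∂(surf n) = ∫ x, ξ x ^ 2 ∂(surf n)
      - 2 * ∫ x, ξ x * pEval p (x : Space n) ∂(surf n)
      + ∫ x, pEval p (x : Space n) ^ 2 ∂(surf n) := by
    have i1 := hξ.integrable_sq
    have i2 := (integrable_mul_of_memLp hξ (hL p)).const_mul 2
    have i3 : Integrable (fun x => ξ x ^ 2 - 2 * (ξ x * pEval p (x : Space n))) (surf n) :=
      i1.sub i2
    simp only [sub_sq, mul_assoc]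
    rw [integral_add i3 (hL p).integrable_sq, integral_sub i1 i2, integral_const_mul]
  rw [h4, h3, hsum ξ hξ] at hp
  rw [Finset.sum_sub_distrib, ← Finset.mul_sum] at h2
  have h5 : eigenvalue n K * (ε / (eigenvalue n K + 1)) ≤ ε := by
    rw [mul_div_assoc', mul_comm, mul_div_assoc]
    exact mul_le_of_le_one_right hε.le ((div_le_one (by positivity)).2 (by linarith))
  have h6 := mul_le_mul_of_nonneg_left hp hΛ
  nlinarith

/-! ### Orthogonality of symmetric functions to degrees 0, 1 and 2 -/

theorem EvenlySpread.integral_mul_linear_eq_zero (hq : EvenlySpread q) (hn : 1 ≤ n)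
    {ξ : Sph n → ℝ} (hξ : MemLp ξ 2 (surf n)) (hs : IsSymmetric q ξ) (v : Space n) :
    ∫ x, ξ x * inner ℝ v (x : Space n) ∂(surf n) = 0 := by
  have hint : ∀ v : Space n, Integrable (fun x => ξ x * inner ℝ v (x : Space n)) (surf n) :=
    fun v => integrable_mul_of_memLp hξ
      (memLp_of_continuous (continuous_const.inner continuous_subtype_val))
  let l : Space n →ₗ[ℝ] ℝ :=
    { toFun := fun v => ∫ x, ξ x * inner ℝ v (x : Space n) ∂(surf n)
      map_add' := fun v w => by
        simp only [inner_add_left, mul_add]; exact integral_add (hint v) (hint w)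
      map_smul' := fun c v => by
        simp only [real_inner_smul_left, mul_left_comm _ c]; exact integral_const_mul _ _ }
  have hl := hq.linear_eq_zero hn l fun φ hφ v => by
    change ∫ x, ξ x * inner ℝ (φ v) (x : Space n) ∂(surf n) =
      ∫ x, ξ x * inner ℝ v (x : Space n) ∂(surf n)
    rw [← integral_comp_onSphere φ]
    refine integral_congr_ae ?_
    filter_upwards [hs φ hφ] with x hx
    rw [hx, onSphere_apply, LinearIsometryEquiv.inner_map_map]
  exact LinearMap.congr_fun hl v

theorem EvenlySpread.exists_integral_mul_bilinear (hq : EvenlySpread q) (hn : 1 ≤ n)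
    {ξ : Sph n → ℝ} (hξ : MemLp ξ 2 (surf n)) (hs : IsSymmetric q ξ) :
    ∃ c : ℝ, ∀ v w : Space n, ∫ x, ξ x * (inner ℝ v (x : Space n) * inner ℝ w (x : Space n))
      ∂(surf n) = c * inner ℝ v w := by
  have hint : ∀ v w : Space n, Integrable
      (fun x => ξ x * (inner ℝ v (x : Space n) * inner ℝ w (x : Space n))) (surf n) :=
    fun v w => integrable_mul_of_memLp hξ
      (memLp_of_continuous ((continuous_const.inner continuous_subtype_val).mul
        (continuous_const.inner continuous_subtype_val)))
  let B : Space n →ₗ[ℝ] Space n →ₗ[ℝ] ℝ := LinearMap.mk₂ ℝ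
    (fun v w => ∫ x, ξ x * (inner ℝ v (x : Space n) * inner ℝ w (x : Space n)) ∂(surf n))
    (fun v v' w => by
      simp only [inner_add_left, mul_add, add_mul]; exact integral_add (hint v w) (hint v' w))
    (fun c v w => by
      simp only [real_inner_smul_left, mul_assoc, mul_left_comm _ c]
      exact integral_const_mul _ _)
    (fun v w w' => by
      simp only [inner_add_left, mul_add]; exact integral_add (hint v w) (hint v w'))
    (fun c v w => by
      simp only [real_inner_smul_left, mul_left_comm _ c]
      exact integral_const_mul _ _)
  have hBv : ∀ v w, B v w =
    ∫ x, ξ x * (inner ℝ v (x : Space n) * inner ℝ w (x : Space n)) ∂(surf n) := fun _ _ => rfl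
  obtain ⟨c, hc⟩ := hq.bilinear_eq_inner hn B (fun v w => by
    simp only [hBv, mul_comm (inner ℝ v _)]) (fun φ hφ v w => by
      rw [hBv, hBv, ← integral_comp_onSphere φ]
      refine integral_congr_ae ?_
      filter_upwards [hs φ hφ] with x hx
      rw [hx, onSphere_apply, LinearIsometryEquiv.inner_map_map, LinearIsometryEquiv.inner_map_map])
  exact ⟨c, hc⟩

theorem exists_pEval_eq_const {p : MvPolynomial (Fin (n + 1)) ℝ} (hp : p.IsHomogeneous 0) :
    ∃ c, ∀ x, pEval p x = c := by
  rw [← totalDegree_zero_iff_isHomogeneous, totalDegree_eq_zero_iff_eq_C] at hp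
  exact ⟨coeff 0 p, fun x => by rw [pEval, hp]; simp⟩

theorem EvenlySpread.integral_mul_degree_one (hq : EvenlySpread q) (hn : 1 ≤ n)
    {ξ : Sph n → ℝ} (hξ : MemLp ξ 2 (surf n)) (hs : IsSymmetric q ξ)
    {p : MvPolynomial (Fin (n + 1)) ℝ} (hp : p.IsHomogeneous 1) :
    ∫ x, ξ x * pEval p (x : Space n) ∂(surf n) = 0 := by
  choose c hc using fun i => exists_pEval_eq_const (hp.pderiv (i := i))
  rw [← hq.integral_mul_linear_eq_zero hn hξ hs (WithLp.toLp 2 c)]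
  refine integral_congr_ae (.of_forall fun x => ?_)
  have h := inner_polyGrad_self hp (x : Space n)
  rw [Nat.cast_one, one_mul] at h
  have h2 : polyGrad p (x : Space n) = WithLp.toLp 2 c := by ext i; simp [polyGrad, hc]
  simp only
  rw [← h, h2]

/-- The second moments of `ξ` are a multiple of the identity, so integrating against a quadratic
form gives a multiple of its trace, which vanishes for a harmonic one. -/
theorem EvenlySpread.integral_mul_degree_two (hq : EvenlySpread q) (hn : 1 ≤ n)
    {ξ : Sph n → ℝ} (hξ : MemLp ξ 2 (surf n)) (hs : IsSymmetric q ξ)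
    {p : MvPolynomial (Fin (n + 1)) ℝ} (hp : p.IsHomogeneous 2) (hl : lap (n + 1) p = 0) :
    ∫ x, ξ x * pEval p (x : Space n) ∂(surf n) = 0 := by
  choose c hc using fun i j => exists_pEval_eq_const ((hp.pderiv (i := i)).pderiv (i := j))
  obtain ⟨m, hm⟩ := hq.exists_integral_mul_bilinear hn hξ hs
  let e : Fin (n + 1) → Space n := fun i => EuclideanSpace.single i 1
  have hexp : ∀ x : Space n, pEval p x =
      ∑ i, (1 / 2 : ℝ) * (inner ℝ (e i) x * inner ℝ (WithLp.toLp 2 (c i)) x) := by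
    intro x
    have h0 := inner_polyGrad_self hp x
    rw [inner_polyGrad] at h0
    have h1 : ∀ i, pEval (pderiv i p) x = inner ℝ (WithLp.toLp 2 (c i)) x := by
      intro i
      have h := inner_polyGrad_self (hp.pderiv (i := i)) x
      have h2 : polyGrad (pderiv i p) x = WithLp.toLp 2 (c i) := by ext j; simp [polyGrad, hc]
      rw [h2] at h
      rw [h]
      simp
    simp only [h1] at h0
    rw [← Finset.mul_sum]
    have h2 : ∀ i, inner ℝ (e i) x = x i := fun i => by simp [e, EuclideanSpace.inner_single_left]
    simp only [h2]
    rw [h0]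
    push_cast
    ring
  have hint : ∀ i, Integrable (fun x : Sph n => ξ x *
      ((1 / 2 : ℝ) * (inner ℝ (e i) (x : Space n) * inner ℝ (WithLp.toLp 2 (c i)) (x : Space n))))
      (surf n) := fun i => integrable_mul_of_memLp hξ
    (memLp_of_continuous (continuous_const.mul
      ((continuous_const.inner continuous_subtype_val).mul
        (continuous_const.inner continuous_subtype_val))))
  simp only [hexp, Finset.mul_sum]
  rw [integral_finsetSum _ fun i _ => hint i]
  simp only [mul_left_comm _ (1 / 2 : ℝ), integral_const_mul, hm]
  have htr : ∑ i, c i i = 0 := by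
    rw [lap_apply] at hl
    have := congrArg (fun r => pEval r (0 : Space n)) hl
    simp only [pEval, map_sum] at this
    simpa [← hc _ _ (0 : Space n), pEval] using this
  rw [← Finset.mul_sum, ← Finset.mul_sum]
  have : ∀ i, inner ℝ (e i) (WithLp.toLp 2 (c i)) = c i i := fun i => by
    simp [e, EuclideanSpace.inner_single_left]
  simp only [this, htr, mul_zero]

theorem integral_mul_degree_zero {ξ : Sph n → ℝ} (h0 : ∫ x, ξ x ∂(surf n) = 0)
    {p : MvPolynomial (Fin (n + 1)) ℝ} (hp : p.IsHomogeneous 0) :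
    ∫ x, ξ x * pEval p (x : Space n) ∂(surf n) = 0 := by
  obtain ⟨c, hc⟩ := exists_pEval_eq_const hp
  simp only [hc, integral_mul_const, h0, zero_mul]

theorem eigenvalue_three : eigenvalue n 3 = 3 * ((n : ℝ) + 2) := by
  simp only [eigenvalue]
  push_cast
  ring

theorem EvenlySpread.poincareInequality (hq : EvenlySpread q) (hn : 1 ≤ n) :
    PoincareInequality q (eigenvalue n 3) := by
  rintro ξ ⟨⟨hξ, -⟩, h0, hs⟩ G hG
  refine poincare_of_orthogonal hn 3 hξ hG fun k hk p hp hl => ?_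
  interval_cases k
  · exact integral_mul_degree_zero h0 hp
  · exact hq.integral_mul_degree_one hn hξ hs hp
  · exact hq.integral_mul_degree_two hn hξ hs hp hl

/-! ### The extremal cubic, sharpness and minimal degree -/

/-- The linear form given by the inner product with a vector. -/
def linearForm (v : Space n) : MvPolynomial (Fin (n + 1)) ℝ := ∑ j, C (v j) * X j

/-- The sum of the cubes of the linear forms that belong to the vertices. -/
def sumCubes (q : Fin (n + 2) → Sph n) : MvPolynomial (Fin (n + 1)) ℝ :=
  ∑ i, linearForm (q i : Space n) ^ 3

theorem pEval_linearForm (v x : Space n) : pEval (linearForm v) x = inner ℝ v x := by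
  simp [pEval, linearForm, PiLp.inner_apply, mul_comm]

theorem pEval_sumCubes (x : Space n) :
    pEval (sumCubes q) x = ∑ i, inner ℝ (q i : Space n) x ^ 3 := by
  simp only [← pEval_linearForm]
  simp [pEval, sumCubes]

theorem isHomogeneous_sumCubes : (sumCubes q).IsHomogeneous 3 := by
  refine IsHomogeneous.sum _ _ _ fun i _ => ?_
  have : (linearForm (q i : Space n)).IsHomogeneous 1 :=
    IsHomogeneous.sum _ _ _ fun j _ => by
      simpa using (isHomogeneous_C (Fin (n + 1)) ((q i : Space n) j)).mul (isHomogeneous_X ℝ j)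
  simpa using this.pow 3

theorem pderiv_linearForm (v : Space n) (j : Fin (n + 1)) : pderiv j (linearForm v) = C (v j) := by
  simp [linearForm, pderiv_X, Pi.single_apply]

/-- The Laplacian of `⟨v, x⟩ ^ 3` is `6 ⟨v, x⟩` for a unit vector `v`, and the vertices sum to zero.
-/
theorem EvenlySpread.lap_sumCubes (hq : EvenlySpread q) : lap (n + 1) (sumCubes q) = 0 := by
  have h1 : ∀ v : Space n, ‖v‖ = 1 → lap (n + 1) (linearForm v ^ 3) = 6 * linearForm v := by
    intro v hv
    have h2 : ∀ j, pderiv j (pderiv j (linearForm v ^ 3)) = 6 * linearForm v * C (v j ^ 2) := by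
      intro j
      have h3 : pderiv j (3 : MvPolynomial (Fin (n + 1)) ℝ) = 0 := by
        rw [show (3 : MvPolynomial (Fin (n + 1)) ℝ) = C 3 from (map_ofNat C 3).symm, pderiv_C]
      simp only [Derivation.leibniz_pow, Derivation.leibniz, pderiv_linearForm, smul_eq_mul,
        pderiv_C, nsmul_eq_mul, map_pow]
      simp [h3]
      ring
    rw [lap_apply, Finset.sum_congr rfl fun j _ => h2 j, ← Finset.mul_sum, ← map_sum,
      ← EuclideanSpace.real_norm_sq_eq, hv]
    simp
  rw [sumCubes, map_sum, Finset.sum_congr rfl fun i _ => h1 _ (by simp), ← Finset.mul_sum]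
  have : ∑ i, linearForm (q i : Space n) = 0 := by
    simp only [linearForm]
    rw [Finset.sum_comm]
    refine Finset.sum_eq_zero fun j _ => ?_
    rw [← Finset.sum_mul, ← map_sum]
    have := congrArg (fun v : Space n => v j) hq.sum_eq_zero
    simp only [WithLp.ofLp_sum, Finset.sum_apply] at this
    simp [this]
  rw [this, mul_zero]

/-- At a vertex the value is `1 - 1 / (n + 1) ^ 2`, which is positive for `n ≥ 1`. -/
theorem EvenlySpread.sumCubes_ne_zero (hq : EvenlySpread q) (hn : 1 ≤ n) : sumCubes q ≠ 0 := by
  intro h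
  have h1 : pEval (sumCubes q) (q 0 : Space n) = 0 := by rw [h]; simp [pEval]
  rw [pEval_sumCubes, Fin.sum_univ_succ, inner_self_sph,
    Finset.sum_congr rfl fun j _ => by rw [hq.inner_eq (Fin.succ_ne_zero j)]] at h1
  simp only [Finset.sum_const, Finset.card_univ, Fintype.card_fin, nsmul_eq_mul] at h1
  have hn' : (1 : ℝ) ≤ n := by exact_mod_cast hn
  push_cast at h1
  field_simp at h1
  nlinarith

theorem EvenlySpread.pEval_sumCubes_map (hq : EvenlySpread q) {φ : Space n ≃ₗᵢ[ℝ] Space n}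
    (hφ : φ ∈ symRotations q) (x : Space n) :
    pEval (sumCubes q) (φ x) = pEval (sumCubes q) x := by
  have h : ∀ i, ∃ j, (q j : Space n) = φ (q i) := fun i => by
    have : φ (q i) ∈ Set.range (fun i => (q i : Space n)) := by
      rw [← hφ.2]; exact ⟨_, ⟨i, rfl⟩, rfl⟩
    exact this
  choose σ hσ using h
  have hinj : Function.Injective σ := fun i j hij => by
    have : φ (q i) = φ (q j) := by rw [← hσ, ← hσ, hij]
    exact hq.1 (Subtype.ext (φ.injective this))
  rw [pEval_sumCubes, pEval_sumCubes, ← (Finite.injective_iff_bijective.1 hinj).sum_comp]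
  simp only [hσ, LinearIsometryEquiv.inner_map_map]

theorem EvenlySpread.isSymHarmonic_sumCubes (hq : EvenlySpread q) (hn : 1 ≤ n) :
    IsSymHarmonic q 3 (sumCubes q) where
  ne_zero := hq.sumCubes_ne_zero hn
  homogeneous := isHomogeneous_sumCubes
  harmonic := by rw [← lap_apply, hq.lap_sumCubes]
  symmetric _ hφ y := hq.pEval_sumCubes_map hφ y
  mean_zero := by
    -- An odd function has mean zero over the ball, by the substitution `x ↦ -x`.
    have h1 := (LinearIsometryEquiv.neg ℝ (E := Space n)).measurePreserving.setIntegral_preimage_emb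
      (LinearIsometryEquiv.neg ℝ (E := Space n)).toHomeomorph.measurableEmbedding
      (pEval (sumCubes q)) (Metric.ball 0 1)
    have h2 : (LinearIsometryEquiv.neg ℝ (E := Space n)) ⁻¹' Metric.ball 0 1 =
        Metric.ball 0 1 := by
      ext x; simp
    have h3 : ∀ x : Space n, pEval (sumCubes q) (LinearIsometryEquiv.neg ℝ (E := Space n) x) =
        - pEval (sumCubes q) x := fun x => by
      have := pEval_smul (isHomogeneous_sumCubes (q := q)) (-1) x
      simpa [Odd.neg_one_pow (show Odd 3 by decide)] using this
    simp only [h2, h3, integral_neg] at h1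
    change ∫ y in Metric.ball (0 : Space n) 1, pEval (sumCubes q) y = 0
    linarith

theorem IsSymHarmonic.isSymmetric {k : ℕ} {h : MvPolynomial (Fin (n + 1)) ℝ}
    (hh : IsSymHarmonic q k h) : IsSymmetric q (fun x => pEval h (x : Space n)) :=
  fun φ hφ => .of_forall fun x => hh.symmetric φ hφ x

theorem IsSymHarmonic.lap_eq_zero {k : ℕ} {h : MvPolynomial (Fin (n + 1)) ℝ}
    (hh : IsSymHarmonic q k h) : lap (n + 1) h = 0 := by
  rw [lap_apply, hh.harmonic]

theorem IsSymHarmonic.mem_symMeanZero (hn : 1 ≤ n) {k : ℕ} (hk : k ≠ 0)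
    {h : MvPolynomial (Fin (n + 1)) ℝ} (hh : IsSymHarmonic q k h) :
    (fun x : Sph n => pEval h (x : Space n)) ∈ symMeanZero q := by
  refine ⟨⟨memLp_of_continuous (continuous_pEval_sph h), _, isWeakGradient_tanGrad hh.homogeneous⟩,
    ?_, hh.isSymmetric⟩
  have := integral_mul_eq_zero_of_ne hn hk hh.homogeneous hh.lap_eq_zero
    (isHomogeneous_one (Fin (n + 1)) ℝ) (lap_eq_zero_of_degree_le_one zero_le_one
      (isHomogeneous_one (Fin (n + 1)) ℝ))
  simpa [pEval] using this

/-- Testing with `h` itself gives equality at its eigenvalue; `k ≠ 0` makes `h` orthogonal to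
constants on the sphere. -/
theorem PoincareInequality.le_eigenvalue (hn : 1 ≤ n) {c : ℝ} (hc : PoincareInequality q c) {k : ℕ}
    (hk : k ≠ 0) {h : MvPolynomial (Fin (n + 1)) ℝ} (hh : IsSymHarmonic q k h) :
    c ≤ eigenvalue n k := by
  have hw := isWeakGradient_tanGrad hh.homogeneous
  have h1 := hc _ (hh.mem_symMeanZero hn hk) _ hw
  have h2 := integral_inner_weakGradient_tanGrad hw hh.homogeneous hh.lap_eq_zero
  simp only [real_inner_self_eq_norm_sq, ← sq] at h2
  rw [h2] at h1
  exact le_of_mul_le_mul_right h1 (integral_sq_pos hh.homogeneous hh.ne_zero)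

theorem IsSymHarmonic.three_le (hq : EvenlySpread q) (hn : 1 ≤ n) {k : ℕ}
    {h : MvPolynomial (Fin (n + 1)) ℝ} (hh : IsSymHarmonic q k h) : 3 ≤ k := by
  by_contra! hk
  have hL : MemLp (fun x : Sph n => pEval h (x : Space n)) 2 (surf n) :=
    memLp_of_continuous (continuous_pEval_sph h)
  have hpos := integral_sq_pos hh.homogeneous hh.ne_zero
  simp only [sq] at hpos
  have hhom := hh.homogeneous
  interval_cases k
  -- Only in degree 0 is the mean-zero condition on the ball needed, to exclude nonzero constants.
  · obtain ⟨c, hc⟩ := exists_pEval_eq_const hhom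
    have h0 : ∫ y in Metric.ball (0 : Space n) 1, pEval h y = 0 := hh.mean_zero
    have hv : volume.real (Metric.ball (0 : Space n) 1) ≠ 0 :=
      (ENNReal.toReal_pos (Metric.measure_ball_pos _ _ one_pos).ne' measure_ball_lt_top.ne).ne'
    simp only [hc, setIntegral_const, smul_eq_mul] at h0
    have : c = 0 := (mul_eq_zero.1 h0).resolve_left hv
    simp [hc, this] at hpos
  · exact hpos.ne' (hq.integral_mul_degree_one hn hL hh.isSymmetric hhom)
  · exact hpos.ne' (hq.integral_mul_degree_two hn hL hh.isSymmetric hhom hh.lap_eq_zero)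

end Poincare

end SimplexSphere

end

/-- For `n + 2` points spread evenly on `S^n`, the best constant of the Poincaré inequality on
the symmetric functions of mean zero is `3 (n + 2)`, and the least degree of a nonzero symmetric
homogeneous harmonic polynomial of mean zero is `3`. -/
theorem theorem8p1 (n : ℕ) (hn : 1 ≤ n) (q : Fin (n + 2) → SimplexSphere.Sph n)
    (hq : SimplexSphere.EvenlySpread q) :
    IsGreatest {c : ℝ | SimplexSphere.PoincareInequality q c} (3 * ((n : ℝ) + 2)) ∧
      IsLeast {k : ℕ | ∃ h : MvPolynomial (Fin (n + 1)) ℝ, SimplexSphere.IsSymHarmonic q k h} 3 := by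
  have h3 := hq.isSymHarmonic_sumCubes hn
  refine ⟨⟨?_, fun c hc => ?_⟩, ⟨_, h3⟩, ?_⟩
  · rw [← SimplexSphere.eigenvalue_three]
    exact hq.poincareInequality hn
  · rw [← SimplexSphere.eigenvalue_three]
    exact SimplexSphere.PoincareInequality.le_eigenvalue hn hc three_ne_zero h3
  · rintro k ⟨h, hh⟩
    exact hh.three_le hq hn
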